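/- Let $k$ be a field, $Q$ a finite quiver and $I$ an admissible ideal of the path algebra $kQ$ (every path occurring in an element of $I$ has length at least two, and for some $N>1$ all paths of length $N$ lie in $I$), and let $\Lambda = kQ/I$ be the corresponding bound quiver algebra. Paths are multiplied from left to right ($pq$ is $p$ followed by $q$), and modules are left modules unless stated otherwise. For a ring $R$ let $\operatorname{fpd} R$ (resp. $\operatorname{Fpd} R$) be the supremum of the projective dimensions of the finitely generated (resp. all) $R$-modules of finite projective dimension, and $\operatorname{gd} R$ the global dimension. For a set $A$ of arrows let $\langle A+I\rangle$ be the ideal of $\Lambda$ generated by the arrows in $A$. For $z\in kQ$ write $z=z_A+z_{\neg A}$, where $z_A$ is a combination of paths passing through some arrow of $A$ and $z_{\neg A}$ is a combination of paths avoiding all arrows of $A$. The set $A$ is *pre-removable* in $\Lambda$ if $z_A, z_{\neg A}\in I$ for every $z\in I$. A pre-removable set $A$ is *removable* in $\Lambda$ if $\langle A+I\rangle$ has finite projective dimension as a right $\Lambda$-module and, in addition, it has finite projective dimension as a left $\Lambda$-module or $\langle A+I\rangle^2=0$. For $A$ pre-removable, the *canonical representation* of $\Lambda/\langle A+I\rangle$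 as a bound quiver algebra is $kQ'/I'$, where $Q'$ is $Q$ with the arrows of $A$ removed and $I'=I\cap kQ'$; removability of sets of arrows in the quotient is understood with respect to it. A set $A$ of arrows is *eventually removable* in $\Lambda$ if it has an ordered partition $A=A_1\,\dot\cup\cdots\dot\cup\,A_m$ such that $A_j$ is removable in $\Lambda/\langle (A_1\cup\dots\cup A_{j-1})+I\rangle$ for every $j=1,\dots,m$. Then there is a unique maximal eventually removable set $A^{\mathrm{er}}_\Lambda$ of arrows in $\Lambda$. Let $\Lambda_{\mathrm{ARV}}$, the *arrow reduced version* of $\Lambda$, be the canonical representation of $\Lambda/\langle A^{\mathrm{er}}_\Lambda+I\rangle$. Then $$\operatorname{fpd}\Lambda<\infty \iff \operatorname{fpd}\Lambda_{\mathrm{ARV}}<\infty,\qquad \operatorname{Fpd}\Lambda<\infty \iff \operatorname{Fpd}\Lambda_{\mathrm{ARV}}<\infty,\qquad \operatorname{gd}\Lambda<\infty \iff \operatorname{gd}\Lambda_{\mathrm{ARV}}<\infty,$$ and moreover $\operatorname{gd}\Lambda<\infty$ if and only if $\Lambda_{\mathrm{ARV}}$ is semisimple. -/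

import Mathlib

open CategoryTheory Quiver

universe u v w

noncomputable section

/-! ### Homological dimensions of a ring (left modules) -/

/-- The little finitistic dimension: the supremum of the projective dimensions of the finitely
generated left modules of finite projective dimension. -/
def littleFinitisticDimension (R : Type u) [Ring R] : WithBot ℕ∞ :=
  ⨆ (M : ModuleCat.{u} R) (_ : Module.Finite R M) (_ : projectiveDimension M < ⊤),
    projectiveDimension M

/-- The big finitistic dimension: the supremum of the projective dimensions of all left modules of
finite projective dimension. -/
def bigFinitisticDimension (R : Type u) [Ring R] : WithBot ℕ∞ :=
  ⨆ (M : ModuleCat.{u} R) (_ : projectiveDimension M < ⊤), projectiveDimension M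

/-- The (left) global dimension. -/
def globalDimension (R : Type u) [Ring R] : WithBot ℕ∞ :=
  ⨆ M : ModuleCat.{u} R, projectiveDimension M

/-! ### Paths and path algebras -/

/-- A path of the quiver `V`, with arbitrary source and target. -/
structure QuiverPath (V : Type v) [Quiver.{w} V] where
  src : V
  tgt : V
  path : Path src tgt

/-- The length of a path, i.e. its number of arrows. -/
def QuiverPath.length {V : Type v} [Quiver.{w} V] (p : QuiverPath V) : ℕ :=
  p.path.length

/-- The trivial path at a vertex. -/
def QuiverPath.trivial {V : Type v} [Quiver.{w} V] (a : V) : QuiverPath V :=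
  ⟨a, a, Path.nil⟩

/-- The path of length one given by an arrow. -/
def QuiverPath.ofArrow {V : Type v} [Quiver.{w} V] (α : Total V) : QuiverPath V :=
  ⟨α.left, α.right, α.hom.toPath⟩

/-- The path `p` followed by the path `q`, where the target of `p` is the source of `q`. -/
def QuiverPath.comp {V : Type v} [Quiver.{w} V] (p q : QuiverPath V) (h : p.tgt = q.src) :
    QuiverPath V :=
  ⟨p.src, q.tgt, p.path.comp (q.path.cast h.symm rfl)⟩

/-- The path algebra `kQ`: finite formal `k`-linear combinations of paths. -/
def PathAlgebra (k : Type u) (V : Type v) [Field k] [Quiver.{w} V] : Type (max u v w) :=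
  QuiverPath V →₀ k

namespace PathAlgebra

section

variable {k : Type u} {V : Type v} [Field k] [Quiver.{w} V]

instance : AddCommGroup (PathAlgebra k V) := inferInstanceAs (AddCommGroup (QuiverPath V →₀ k))

instance : Module k (PathAlgebra k V) := inferInstanceAs (Module k (QuiverPath V →₀ k))

/-- The basis of the path algebra given by the paths. -/
def basis : Module.Basis (QuiverPath V) k (PathAlgebra k V) := Module.Basis.ofRepr (LinearEquiv.refl k _)

/-- The coefficients of an element of the path algebra with respect to the basis of paths. -/
def coeff (z : PathAlgebra k V) : QuiverPath V →₀ k := basis.repr z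

/-- The element of the path algebra with given coefficients. -/
def ofCoeff (c : QuiverPath V →₀ k) : PathAlgebra k V := basis.repr.symm c

/-- A path, as an element of the path algebra. -/
def ofPath (p : QuiverPath V) : PathAlgebra k V := basis p

/-- An arrow, as an element of the path algebra. -/
def ofArrow (α : Total V) : PathAlgebra k V := ofPath (QuiverPath.ofArrow α)

open Classical in
/-- The product of two paths: their concatenation (`p` first, then `q`) if the target of `p` is the
source of `q`, and zero otherwise. -/
def pathMul (p q : QuiverPath V) : PathAlgebra k V :=
  if h : p.tgt = q.src then ofPath (p.comp q h) else 0

/-- The bilinear extension of the product of paths. -/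
def mulLin : PathAlgebra k V →ₗ[k] PathAlgebra k V →ₗ[k] PathAlgebra k V :=
  basis.constr k fun p => basis.constr k fun q => pathMul p q

instance : Mul (PathAlgebra k V) := ⟨fun x y => mulLin x y⟩

/-- The unit of the path algebra of a quiver with finitely many vertices is the sum of the trivial
paths. -/
instance [Fintype V] : One (PathAlgebra k V) := ⟨∑ a : V, ofPath (QuiverPath.trivial a)⟩

theorem mul_def (x y : PathAlgebra k V) : x * y = mulLin x y := rfl

theorem one_def [Fintype V] : (1 : PathAlgebra k V) = ∑ a : V, ofPath (QuiverPath.trivial a) := rfl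

theorem ofPath_mul_ofPath (p q : QuiverPath V) :
    (ofPath p * ofPath q : PathAlgebra k V) = pathMul p q := by
  simp only [mul_def, mulLin, ofPath, Module.Basis.constr_basis]

theorem induction_on {P : PathAlgebra k V → Prop} (z : PathAlgebra k V)
    (path : ∀ p, P (ofPath p)) (add : ∀ x y, P x → P y → P (x + y))
    (smul : ∀ (c : k) x, P x → P (c • x)) (zero : P 0) : P z := by
  have hz : z ∈ Submodule.span k (Set.range (basis (k := k) (V := V))) := by
    rw [basis.span_eq]; trivial
  induction hz using Submodule.span_induction with
  | mem x h => obtain ⟨p, rfl⟩ := h; exact path p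
  | zero => exact zero
  | add x y _ _ hx hy => exact add x y hx hy
  | smul c x _ hx => exact smul c x hx

theorem pathMul_of_eq {a b c : V} (p : Path a b) (q : Path b c) :
    (pathMul ⟨a, b, p⟩ ⟨b, c, q⟩ : PathAlgebra k V) = ofPath ⟨a, c, p.comp q⟩ := by
  simp [pathMul, QuiverPath.comp]

theorem pathMul_of_ne {p q : QuiverPath V} (h : p.tgt ≠ q.src) :
    (pathMul p q : PathAlgebra k V) = 0 := by
  simp [pathMul, h]

theorem ofPath_mul_assoc (p q r : QuiverPath V) :
    (ofPath p * ofPath q * ofPath r : PathAlgebra k V) = ofPath p * (ofPath q * ofPath r) := by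
  obtain ⟨a, b, p⟩ := p
  obtain ⟨c, d, q⟩ := q
  obtain ⟨e, f, r⟩ := r
  simp only [ofPath_mul_ofPath]
  by_cases h : b = c
  · subst h
    by_cases h' : d = e
    · subst h'
      simp only [pathMul_of_eq, ofPath_mul_ofPath, Path.comp_assoc]
    · rw [pathMul_of_eq, ofPath_mul_ofPath, pathMul_of_ne h', pathMul_of_ne h', mul_def, map_zero]
  · rw [pathMul_of_ne h, mul_def, map_zero, LinearMap.zero_apply]
    by_cases h' : d = e
    · subst h'
      rw [pathMul_of_eq, ofPath_mul_ofPath, pathMul_of_ne h]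
    · rw [pathMul_of_ne h', mul_def, map_zero]

theorem one_mulLin [Fintype V] (x : PathAlgebra k V) : mulLin 1 x = x := by
  induction x using induction_on with
  | path p =>
    obtain ⟨a, b, p⟩ := p
    rw [one_def, map_sum, LinearMap.sum_apply, Finset.sum_eq_single a]
    · rw [← mul_def, ofPath_mul_ofPath, QuiverPath.trivial, pathMul_of_eq, Path.nil_comp]
    · intro c _ hc
      rw [← mul_def, ofPath_mul_ofPath, pathMul_of_ne hc]
    · simp
  | add x y hx hy => rw [map_add, hx, hy]
  | smul c x hx => rw [map_smul, hx]
  | zero => rw [map_zero]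

theorem mulLin_one [Fintype V] (x : PathAlgebra k V) : mulLin x 1 = x := by
  induction x using induction_on with
  | path p =>
    obtain ⟨a, b, p⟩ := p
    rw [one_def, map_sum, Finset.sum_eq_single b]
    · rw [← mul_def, ofPath_mul_ofPath, QuiverPath.trivial, pathMul_of_eq, Path.comp_nil]
    · intro c _ hc
      rw [← mul_def, ofPath_mul_ofPath, pathMul_of_ne (fun h => hc h.symm)]
    · simp
  | add x y hx hy => rw [map_add, LinearMap.add_apply, hx, hy]
  | smul c x hx => rw [map_smul, LinearMap.smul_apply, hx]
  | zero => rw [map_zero, LinearMap.zero_apply]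

theorem mulLin_assoc (x y z : PathAlgebra k V) :
    mulLin (mulLin x y) z = mulLin x (mulLin y z) := by
  induction x using induction_on with
  | path p =>
    induction y using induction_on with
    | path q =>
      induction z using induction_on with
      | path r => exact ofPath_mul_assoc p q r
      | add x y hx hy => simp only [map_add, hx, hy]
      | smul c x hx => simp only [map_smul, hx]
      | zero => simp only [map_zero]
    | add x y hx hy => simp only [map_add, LinearMap.add_apply, hx, hy]
    | smul c x hx => simp only [map_smul, LinearMap.smul_apply, hx]
    | zero => simp only [map_zero, LinearMap.zero_apply]
  | add x y hx hy => simp only [map_add, LinearMap.add_apply, hx, hy]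
  | smul c x hx => simp only [map_smul, LinearMap.smul_apply, hx]
  | zero => simp only [map_zero, LinearMap.zero_apply]

/-- The ring structure of the path algebra. -/
instance [Fintype V] : Ring (PathAlgebra k V) :=
  { (inferInstance : AddCommGroup (PathAlgebra k V)),
    (inferInstance : Mul (PathAlgebra k V)),
    (inferInstance : One (PathAlgebra k V)) with
    left_distrib := fun x y z => map_add (mulLin x) y z
    right_distrib := fun x y z => by simp only [mul_def, map_add, LinearMap.add_apply]
    zero_mul := fun x => by simp only [mul_def, map_zero, LinearMap.zero_apply]
    mul_zero := fun x => map_zero (mulLin x)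
    mul_assoc := mulLin_assoc
    one_mul := one_mulLin
    mul_one := mulLin_one }

/-- The `k`-algebra structure of the path algebra. -/
instance [Fintype V] : Algebra k (PathAlgebra k V) :=
  Algebra.ofModule (fun c x y => by simp only [mul_def, map_smul, LinearMap.smul_apply])
    (fun c x y => by simp only [mul_def, map_smul])

end

end PathAlgebra

/-! ### Removing arrows from a quiver -/

/-- The path passes through at least one arrow in the set `A` at least once. -/
def QuiverPath.pathPassesThrough {V : Type v} [Quiver.{w} V] (A : Set (Total V)) {a : V} :
    ∀ {b : V}, Path a b → Prop
  | _, .nil => False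
  | _, .cons p α => pathPassesThrough A p ∨ ⟨_, _, α⟩ ∈ A

/-- The path passes through at least one arrow in the set `A` at least once. -/
def QuiverPath.PassesThrough {V : Type v} [Quiver.{w} V] (p : QuiverPath V) (A : Set (Total V)) :
    Prop :=
  QuiverPath.pathPassesThrough A p.path

/-- The quiver that results from `V` by removing the arrows in `A`; it has the same vertices. -/
def removeArrows {V : Type v} [Quiver.{w} V] (A : Set (Total V)) : WideSubquiver V :=
  fun a b => {α : a ⟶ b | (⟨a, b, α⟩ : Total V) ∉ A}

instance {V : Type v} [Quiver.{w} V] [Fintype V] (H : WideSubquiver V) : Fintype H :=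
  inferInstanceAs (Fintype V)

/-- The inclusion of a wide subquiver. -/
def wideInclusion {V : Type v} [Quiver.{w} V] (H : WideSubquiver V) : H ⥤q V where
  obj a := a
  map α := α.1

/-- A path of a wide subquiver, as a path of the ambient quiver. -/
def QuiverPath.toAmbient {V : Type v} [Quiver.{w} V] (H : WideSubquiver V) (p : QuiverPath H) :
    QuiverPath V :=
  ⟨(wideInclusion H).obj p.src, (wideInclusion H).obj p.tgt, (wideInclusion H).mapPath p.path⟩

/-- The arrows of a wide subquiver that belong to a set `B` of arrows of the ambient quiver. -/
def restrictArrows {V : Type v} [Quiver.{w} V] (H : WideSubquiver V) (B : Set (Total V)) :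
    Set (Total H) :=
  {α | (⟨(wideInclusion H).obj α.left, (wideInclusion H).obj α.right,
    (wideInclusion H).map α.hom⟩ : Total V) ∈ B}

namespace PathAlgebra

/-- The linear map between path algebras induced by the inclusion of a wide subquiver. -/
def inclusionLin (k : Type u) {V : Type v} [Field k] [Quiver.{w} V] (H : WideSubquiver V) :
    PathAlgebra k H →ₗ[k] PathAlgebra k V :=
  basis.constr k fun p => ofPath (p.toAmbient H)

theorem inclusionLin_ofPath (k : Type u) {V : Type v} [Field k] [Quiver.{w} V]
    (H : WideSubquiver V) (p : QuiverPath H) :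
    inclusionLin k H (ofPath p) = ofPath (p.toAmbient H) :=
  basis.constr_basis k _ p

theorem inclusionLin_mul (k : Type u) {V : Type v} [Field k] [Quiver.{w} V] [Fintype V]
    (H : WideSubquiver V) (x y : PathAlgebra k H) :
    inclusionLin k H (x * y) = inclusionLin k H x * inclusionLin k H y := by
  induction x using induction_on with
  | path p =>
    induction y using induction_on with
    | path q =>
      obtain ⟨a, b, p⟩ := p
      obtain ⟨c, d, q⟩ := q
      rw [ofPath_mul_ofPath, inclusionLin_ofPath, inclusionLin_ofPath, ofPath_mul_ofPath]
      by_cases h : b = c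
      · subst h
        rw [pathMul_of_eq, inclusionLin_ofPath]
        simp only [QuiverPath.toAmbient]
        rw [pathMul_of_eq, Prefunctor.mapPath_comp]
      · rw [pathMul_of_ne h, map_zero, pathMul_of_ne]
        exact h
    | add x y hx hy => simp only [mul_add, map_add, hx, hy]
    | smul c x hx => simp only [mul_smul_comm, map_smul, hx]
    | zero => simp only [mul_zero, map_zero]
  | add x y hx hy => simp only [add_mul, map_add, hx, hy]
  | smul c x hx => simp only [smul_mul_assoc, map_smul, hx]
  | zero => simp only [zero_mul, map_zero]

theorem inclusionLin_one (k : Type u) {V : Type v} [Field k] [Quiver.{w} V] [Fintype V]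
    (H : WideSubquiver V) : inclusionLin k H 1 = 1 := by
  rw [one_def, one_def, map_sum]
  refine Finset.sum_congr rfl fun a _ => ?_
  rw [inclusionLin_ofPath]
  rfl

/-- The inclusion of path algebras induced by the inclusion of a wide subquiver. -/
def inclusion (k : Type u) {V : Type v} [Field k] [Quiver.{w} V] [Fintype V]
    (H : WideSubquiver V) : PathAlgebra k H →ₐ[k] PathAlgebra k V :=
  AlgHom.ofLinearMap (inclusionLin k H) (inclusionLin_one k H) (inclusionLin_mul k H)

/-- The component `z_A` of `z`: the part consisting of the paths passing through `A`. -/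
def through {k : Type u} {V : Type v} [Field k] [Quiver.{w} V] (A : Set (Total V))
    (z : PathAlgebra k V) : PathAlgebra k V :=
  open Classical in ofCoeff ((coeff z).filter fun p => p.PassesThrough A)

/-- The component `z_{¬A}` of `z`: the part consisting of the paths avoiding all arrows in `A`. -/
def avoiding {k : Type u} {V : Type v} [Field k] [Quiver.{w} V] (A : Set (Total V))
    (z : PathAlgebra k V) : PathAlgebra k V :=
  open Classical in ofCoeff ((coeff z).filter fun p => ¬ p.PassesThrough A)

end PathAlgebra

/-! ### Bound quiver algebras and removable sets of arrows

A bound quiver algebra is given by a quiver `V` with finitely many vertices and arrows, a field `k`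
and an admissible ideal `I` of the path algebra; the algebra itself is the quotient ring
`PathAlgebra k V ⧸ I`. -/

section

variable {k : Type u} {V : Type v} [Field k] [Quiver.{w} V] [Fintype V]

/-- The two-sided ideal `I` is admissible: all paths occurring in it have length at least two, and
for some `N > 1` it contains all paths of length `N`. -/
structure IsAdmissible (I : Ideal (PathAlgebra k V)) : Prop where
  two_le_length : ∀ z ∈ I, ∀ p ∈ (PathAlgebra.coeff z).support, 2 ≤ p.length
  exists_length : ∃ N : ℕ, 1 < N ∧ ∀ p : QuiverPath V, p.length = N → PathAlgebra.ofPath p ∈ I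

/-- The ideal `⟨A + I⟩` of `kQ / I` generated by the arrows in `A`. -/
def arrowIdeal (I : Ideal (PathAlgebra k V)) [I.IsTwoSided] (A : Set (Total V)) :
    TwoSidedIdeal (PathAlgebra k V ⧸ I) :=
  TwoSidedIdeal.span ((fun α => Ideal.Quotient.mk I (PathAlgebra.ofArrow α)) '' A)

/-- The set `A` of arrows is pre-removable in `kQ / I`: the components `z_A` and `z_{¬A}` of every
`z ∈ I` belong to `I`. -/
def IsPreRemovable (I : Ideal (PathAlgebra k V)) (A : Set (Total V)) : Prop :=
  ∀ z ∈ I, PathAlgebra.through A z ∈ I ∧ PathAlgebra.avoiding A z ∈ I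

/-- `⟨A + I⟩` has finite projective dimension as a left `kQ / I`-module. -/
def HasFiniteLeftPD (I : Ideal (PathAlgebra k V)) [I.IsTwoSided] (A : Set (Total V)) : Prop :=
  projectiveDimension (ModuleCat.of (PathAlgebra k V ⧸ I) (arrowIdeal I A)) < ⊤

/-- `⟨A + I⟩` has finite projective dimension as a right `kQ / I`-module. -/
def HasFiniteRightPD (I : Ideal (PathAlgebra k V)) [I.IsTwoSided] (A : Set (Total V)) : Prop :=
  projectiveDimension (ModuleCat.of (PathAlgebra k V ⧸ I)ᵐᵒᵖ (arrowIdeal I A)) < ⊤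

/-- `A` is non-repetitive: the square of the ideal `⟨A + I⟩` is zero. -/
def IsNonRepetitive (I : Ideal (PathAlgebra k V)) [I.IsTwoSided] (A : Set (Total V)) : Prop :=
  ∀ x ∈ arrowIdeal I A, ∀ y ∈ arrowIdeal I A, x * y = 0

/-- `A` is two-sided removable in `kQ / I`. -/
def IsTwoSidedRemovable (I : Ideal (PathAlgebra k V)) [I.IsTwoSided] (A : Set (Total V)) : Prop :=
  IsPreRemovable I A ∧ HasFiniteRightPD I A ∧ HasFiniteLeftPD I A

/-- `A` is only left removable in `kQ / I`. -/
def IsOnlyLeftRemovable (I : Ideal (PathAlgebra k V)) [I.IsTwoSided] (A : Set (Total V)) : Prop :=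
  IsPreRemovable I A ∧ IsNonRepetitive I A ∧ HasFiniteRightPD I A ∧ ¬ HasFiniteLeftPD I A

/-- `A` is (left) removable in `kQ / I`. -/
def IsRemovable (I : Ideal (PathAlgebra k V)) [I.IsTwoSided] (A : Set (Total V)) : Prop :=
  IsTwoSidedRemovable I A ∨ IsOnlyLeftRemovable I A

/-- The ideal `I'` of the path algebra of the quiver `Q'` without the arrows in `A`, consisting of
the elements of `kQ'` that belong to `I`. For `A` pre-removable, `kQ' / I'` is the canonical
representation of `(kQ / I) / ⟨A + I⟩` as a bound quiver algebra. -/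
def canonicalIdeal (I : Ideal (PathAlgebra k V)) (A : Set (Total V)) :
    Ideal (PathAlgebra k (removeArrows A)) :=
  I.comap (PathAlgebra.inclusion k (removeArrows A))

instance (I : Ideal (PathAlgebra k V)) [I.IsTwoSided] (A : Set (Total V)) :
    (canonicalIdeal I A).IsTwoSided :=
  inferInstanceAs (I.comap (PathAlgebra.inclusion k (removeArrows A))).IsTwoSided

/-- `B` is removable in the canonical representation of `(kQ / I) / ⟨A + I⟩`. -/
def IsRemovableAfter (I : Ideal (PathAlgebra k V)) [I.IsTwoSided] (A B : Set (Total V)) : Prop :=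
  IsRemovable (canonicalIdeal I A) (restrictArrows (removeArrows A) B)

/-- `A` is eventually removable in `kQ / I`: it has an ordered partition `P 0, …, P (m - 1)` such
that each `P j` is removable after the union of the preceding parts has been removed. -/
def IsEventuallyRemovable (I : Ideal (PathAlgebra k V)) [I.IsTwoSided] (A : Set (Total V)) : Prop :=
  ∃ (m : ℕ) (P : Fin m → Set (Total V)),
    Pairwise (fun i j => Disjoint (P i) (P j)) ∧ (⋃ j, P j) = A ∧
      ∀ j, IsRemovableAfter I (⋃ (i : Fin m) (_ : i < j), P i) (P j)

/-- `A` is a maximal eventually removable set of arrows (with respect to inclusion). -/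
def IsMaximalEventuallyRemovable (I : Ideal (PathAlgebra k V)) [I.IsTwoSided]
    (A : Set (Total V)) : Prop :=
  Maximal (IsEventuallyRemovable I) A

/-- The bound quiver algebra that is the canonical representation of `(kQ / I) / ⟨A + I⟩`. When `A`
is the maximal eventually removable set of arrows, this is the arrow reduced version of `kQ / I`. -/
abbrev CanonicalRepresentation (I : Ideal (PathAlgebra k V)) [I.IsTwoSided] (A : Set (Total V)) :
    Type (max u v w) :=
  PathAlgebra k (removeArrows A) ⧸ canonicalIdeal I A

end

end

noncomputable section

/-! ### Short exact sequences and extension of scalars -/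

section Homological

open Limits Abelian

/-! Everything reduces to one removal step. If `U` and `U ∪ B` are pre-removable, let `R` and `S` be
the algebras left after removing `U` and `U ∪ B`. Killing the paths through `B` is a ring surjection
`π : R → S` with a section `ν` (inclusion of paths), and its kernel `K` is the nilpotent ideal
generated by `B`. The rest of the step is about such split surjections.

From `S` to `R`: if `K` has finite right projective dimension, then so has `S` as a right
`R`-module, hence `Tor_i^R(S, M) = 0` for all `M` and all `i` above a uniform `c`. A `c`-th syzygy
`Y` of `M` is therefore acyclic for `S ⊗_R -`. For acyclic `Y` the functor keeps resolutions exact,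
and since `K` is nilpotent, projectivity of `S ⊗_R Y` lifts to `Y`. So bounds pass from `S` to `R`
at the cost of `c` (`HasFinitisticBound.of_quotient`, `HasGlobalBound.of_quotient`). Tensor products
appear as left adjoints of restriction of scalars, and Tor through its character dual `Ext_R(M,
Hom_ℤ(S, ℚ/ℤ))`, where `Hom_ℤ(S, ℚ/ℤ)` is a coseparator of `S`-modules.

From `R` to `S`: if a module over `S` is a semilinear retract of a module over `R`, its projective
dimension is no larger (`hasProjectiveDimensionLT_of_semilinear_retract`). An `S`-module is such a
retract of its restriction along `π`, which has finite projective dimension when `K` has finite left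
projective dimension. If instead `K² = 0`, a high syzygy over `S` is a retract of its extension of
scalars along `ν`. For global dimension the restriction along `π` always suffices.

The same retract lemma shows that removability survives the prior removal of a larger pre-removable
set (`IsRemovableAfter.mono`). Eventually removable sets are thus closed under unions, which gives
the unique maximal one. Finally, if the global dimension is finite, the set of all arrows is
removable, so the arrow reduced version has no arrows and is a quotient of a finite product of
copies of `k`. -/

theorem isRightAdjoint_restrictScalars {R S : Type u} [Ring R] [Ring S] (f : R →+* S) :
    (ModuleCat.restrictScalars.{u} f).IsRightAdjoint := by
  have : PreservesLimits (ModuleCat.restrictScalars.{u} f) := ⟨⟨inferInstance⟩⟩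
  -- The special adjoint functor theorem supplies the left adjoint that plays the role of `S ⊗_R -`.
  have h := isCoseparator_coseparator (ModuleCat.{u} S)
  exact isRightAdjoint_of_preservesLimits_of_isCoseparating h _

/-- The short exact sequence of modules given by a surjective linear map. -/
theorem shortExact_ker {R : Type u} [Ring R] {P M : Type u} [AddCommGroup P] [AddCommGroup M]
    [Module R P] [Module R M] (g : P →ₗ[R] M) (hg : Function.Surjective g) :
    g.shortComplexKer.ShortExact :=
  LinearMap.shortExact_shortComplexKer hg

/-- The proposition `p` is a switch: with `p = True` the construction stays within finitely
generated modules (hence the Noetherian hypothesis), with `p = False` it concerns all modules. This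
lets one proof serve both finitistic dimensions. -/
theorem exists_presentation {R : Type u} [Ring R] (p : Prop) (hR : p → IsNoetherianRing R)
    (M : ModuleCat.{u} R) (hM : p → Module.Finite R M) :
    ∃ T : ShortComplex (ModuleCat.{u} R), T.ShortExact ∧ Projective T.X₂ ∧ T.X₃ = M ∧
      (p → Module.Finite R T.X₁) := by
  by_cases hp : p
  · have := hR hp
    have := hM hp
    obtain ⟨n, g, hg⟩ := Module.Finite.exists_fin' R M
    let e : (ULift.{u} (Fin n) → R) ≃ₗ[R] (Fin n → R) :=
      LinearEquiv.funCongrLeft R R Equiv.ulift.symm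
    refine ⟨_, shortExact_ker (g ∘ₗ e.toLinearMap) (hg.comp e.surjective), ?_, rfl, fun _ => ?_⟩
    · exact ModuleCat.projective_of_categoryTheory_projective (R := R)
        (P := ModuleCat.of R (ULift.{u} (Fin n) → R))
    · exact inferInstanceAs (Module.Finite R (LinearMap.ker _))
  · exact ⟨_, M.shortExact_projectiveShortComplex,
      ModuleCat.projective_of_categoryTheory_projective _, rfl, fun h => absurd h hp⟩

/-- All positive extension groups of `M` by `Z` vanish. -/
def IsExtAcyclic {R : Type u} [Ring R] (Z M : ModuleCat.{u} R) : Prop :=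
  ∀ i, 1 ≤ i → Subsingleton (Ext M Z i)

theorem ext_X₁_subsingleton {C : Type v} [Category.{w} C] [Abelian C] [HasExt.{w} C]
    {T : ShortComplex C} (hT : T.ShortExact) [Projective T.X₂] (Z : C) (i : ℕ) (hi : 1 ≤ i)
    (h : Subsingleton (Ext T.X₃ Z (i + 1))) : Subsingleton (Ext T.X₁ Z i) := by
  refine subsingleton_of_forall_eq 0 fun x => ?_
  obtain ⟨y, rfl⟩ := Ext.contravariant_sequence_exact₁ hT Z x (add_comm 1 i)
    (Subsingleton.elim _ _)
  obtain ⟨j, rfl⟩ := Nat.exists_eq_add_of_le' hi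
  rw [y.eq_zero_of_projective, Ext.comp_zero]

/-- `Y` is a `c`-th syzygy of `M`: dimension shifting moves the vanishing of Ext from degrees above
`c` to all positive degrees. Going up to `Y` keeps any bound on projective dimension, and coming
back costs `c`. -/
theorem exists_isExtAcyclic_syzygy {R : Type u} [Ring R] (p : Prop) (hR : p → IsNoetherianRing R)
    (Z : ModuleCat.{u} R) (c : ℕ) (M : ModuleCat.{u} R) (hM : p → Module.Finite R M)
    (hc : ∀ i, c + 1 ≤ i → Subsingleton (Ext M Z i)) :
    ∃ Y : ModuleCat.{u} R, (p → Module.Finite R Y) ∧ IsExtAcyclic Z Y ∧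
      (∀ m, HasProjectiveDimensionLT M (m + 1) → HasProjectiveDimensionLT Y (m + 1)) ∧
      (∀ m, HasProjectiveDimensionLT Y (m + 1) → HasProjectiveDimensionLT M (m + c + 1)) := by
  induction c generalizing M with
  | zero => exact ⟨M, hM, fun i hi => hc i (by omega), fun _ h => h, fun _ h => h⟩
  | succ c ih =>
    obtain ⟨T, hT, hP, rfl, hfin⟩ := exists_presentation p hR M hM
    obtain ⟨Y, hY, hYZ, h₁, h₂⟩ := ih T.X₁ hfin fun i hi =>
      ext_X₁_subsingleton hT Z i (by omega) (hc (i + 1) (by omega))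
    refine ⟨Y, hY, hYZ, fun m h => h₁ m ?_, fun m h => ?_⟩
    · exact hT.hasProjectiveDimensionLT_X₁ (m + 1) inferInstance
        (hasProjectiveDimensionLT_of_ge _ (m + 1) (m + 2) (by omega))
    · have := h₂ m h
      exact hT.hasProjectiveDimensionLT_X₃ (m + c + 1) this
        (hasProjectiveDimensionLT_of_ge _ 1 _ (by omega))

/-- The obstruction to extending `g` is its image under the connecting map into `Ext T.X₃ Z 1`. -/
theorem exists_extension_of_ext_one {C : Type v} [Category.{w} C] [Abelian C] [HasExt.{w} C]
    {T : ShortComplex C} (hT : T.ShortExact) {Z : C} (h : Subsingleton (Ext T.X₃ Z 1))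
    (g : T.X₁ ⟶ Z) : ∃ g' : T.X₂ ⟶ Z, T.f ≫ g' = g := by
  obtain ⟨y, hy⟩ := Ext.contravariant_sequence_exact₁ hT Z (Ext.mk₀ g) (add_comm 1 0)
    (Subsingleton.elim _ _)
  obtain ⟨g', rfl⟩ := Ext.homEquiv₀.symm.surjective y
  refine ⟨g', Ext.homEquiv₀.symm.injective ?_⟩
  simpa using hy

/-- A left adjoint functor keeps a short exact sequence exact if its cokernel is acyclic with
respect to the image of a coseparator. -/
theorem shortExact_map_leftAdjoint {R S : Type u} [Ring R] [Ring S]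
    {F : ModuleCat.{u} R ⥤ ModuleCat.{u} S} {G : ModuleCat.{u} S ⥤ ModuleCat.{u} R} (adj : F ⊣ G)
    [F.Additive] {Z : ModuleCat.{u} S} (hZ : IsCoseparator Z) {T : ShortComplex (ModuleCat.{u} R)}
    (hT : T.ShortExact) (h : Subsingleton (Ext T.X₃ (G.obj Z) 1)) : (T.map F).ShortExact := by
  have : PreservesColimits F := adj.leftAdjoint_preservesColimits
  have := hT.epi_g
  have := hT.mono_f
  -- Test against maps `k` into the coseparator `Z`. The adjunct of `k` is a map from `T.X₁` to
  -- `G.obj Z`, which extends over `T.X₂` because the first Ext group vanishes. So `k` factors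
  -- through `F.map T.f`, and anything killed by `F.map T.f` is killed by every `k`.
  have hm : Mono (F.map T.f) := by
    refine Preadditive.mono_of_cancel_zero _ fun {W} g hg => ?_
    refine (isCoseparator_def Z).1 hZ _ _ fun k => ?_
    obtain ⟨k', hk'⟩ := exists_extension_of_ext_one hT h (adj.homEquiv _ _ k)
    have : F.map T.f ≫ (adj.homEquiv _ _).symm k' = k := by
      apply (adj.homEquiv _ _).injective
      rw [adj.homEquiv_naturality_left, Equiv.apply_symm_apply, hk']
    rw [← this, reassoc_of% hg, zero_comp, zero_comp]
  have : PreservesFiniteColimits F := PreservesColimitsOfSize.preservesFiniteColimits F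
  exact { exact := hT.exact.map_of_epi_of_preservesCokernel F inferInstance inferInstance
          mono_f := hm
          epi_g := inferInstanceAs (Epi (F.map T.g)) }

end Homological

/-! ### Projective dimension under a left adjoint on acyclic modules -/

section Homological

open Limits Abelian

/-- All syzygies of an acyclic module are acyclic, so `F` maps a projective resolution to a
projective resolution. `F` preserves projectives because its right adjoint preserves epimorphisms.
-/
theorem hasProjectiveDimensionLT_map_leftAdjoint {R S : Type u} [Ring R] [Ring S]
    {F : ModuleCat.{u} R ⥤ ModuleCat.{u} S} {G : ModuleCat.{u} S ⥤ ModuleCat.{u} R} (adj : F ⊣ G)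
    [F.Additive] [G.PreservesEpimorphisms] {Z : ModuleCat.{u} S} (hZ : IsCoseparator Z) (n : ℕ)
    (M : ModuleCat.{u} R) (hM : IsExtAcyclic (G.obj Z) M)
    (h : HasProjectiveDimensionLT M (n + 1)) : HasProjectiveDimensionLT (F.obj M) (n + 1) := by
  induction n generalizing M with
  | zero =>
    exact projective_iff_hasProjectiveDimensionLT_one.1
      (adj.map_projective M (projective_iff_hasProjectiveDimensionLT_one.2 h))
  | succ n ih =>
    obtain ⟨T, hT, hP, rfl, -⟩ := exists_presentation False (by simp) M (by simp)
    have h₁ := ih T.X₁ (fun i hi => ext_X₁_subsingleton hT _ i hi (hM _ (by omega)))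
      (hT.hasProjectiveDimensionLT_X₁ (n + 1) inferInstance h)
    have := adj.map_projective T.X₂ inferInstance
    exact (shortExact_map_leftAdjoint adj hZ hT (hM 1 le_rfl)).hasProjectiveDimensionLT_X₃ (n + 1)
      h₁ (inferInstanceAs (HasProjectiveDimensionLT (F.obj T.X₂) _) )

/-- Extensions by arbitrary modules vanish if extensions by modules over a quotient ring with
nilpotent kernel vanish. -/
theorem ext_one_subsingleton_of_nilpotent {R S : Type u} [Ring R] [Ring S] (π : R →+* S)
    (ν : S →+* R) (hπν : ∀ s, π (ν s) = s) (M : ModuleCat.{u} R)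
    (h : ∀ X : ModuleCat.{u} S, Subsingleton (Ext M ((ModuleCat.restrictScalars π).obj X) 1))
    (j : ℕ) (N : ModuleCat.{u} R) (hN : RingHom.ker π ^ j • (⊤ : Submodule R N) = ⊥) :
    Subsingleton (Ext M N 1) := by
  induction j generalizing N with
  | zero =>
    have : Subsingleton N := by
      rw [Submodule.pow_zero, Ideal.one_eq_top, Submodule.top_smul] at hN
      exact (Submodule.subsingleton_iff R).1 (subsingleton_of_bot_eq_top hN.symm)
    exact subsingleton_of_forall_eq 0 fun x => by
      rw [← x.comp_mk₀_id, (ModuleCat.isZero_of_subsingleton N).eq_of_src (𝟙 N) 0, Ext.mk₀_zero,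
        Ext.comp_zero]
  | succ j ih =>
    -- Dévissage: `U` is killed by one power of the kernel fewer than `N`, and `N ⧸ U` is
    -- annihilated by the kernel, hence is an `S`-module.
    let U : Submodule R N := RingHom.ker π • ⊤
    have h₁ : Subsingleton (Ext M (ModuleCat.of R U) 1) := by
      refine ih (ModuleCat.of R U) ?_
      refine Submodule.map_injective_of_injective U.injective_subtype ?_
      rw [Submodule.map_smul'', Submodule.map_bot, Submodule.map_top, Submodule.range_subtype,
        ← hN, Submodule.pow_succ, Submodule.mul_smul]
    have h₂ : Subsingleton (Ext M (ModuleCat.of R (N ⧸ U)) 1) := by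
      -- `S` acts through the section. Restricting back along `π` recovers the given action, since
      -- `ν (π r)` and `r` differ by an element of the kernel.
      let : Module S (N ⧸ U) := Module.compHom _ ν
      have key : ∀ (r : R) (x : N ⧸ U), ν (π r) • x = r • x := by
        intro r x
        obtain ⟨x, rfl⟩ := U.mkQ_surjective x
        rw [← sub_eq_zero, ← sub_smul, ← map_smul, Submodule.mkQ_apply, Submodule.Quotient.mk_eq_zero]
        exact Submodule.smul_mem_smul (by simp [RingHom.mem_ker, hπν]) trivial
      let e : ((ModuleCat.restrictScalars π).obj (ModuleCat.of S (N ⧸ U)) : ModuleCat R) ≃ₗ[R]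
          ModuleCat.of R (N ⧸ U) :=
        { AddEquiv.refl (N ⧸ U) with map_smul' := fun r x => key r x }
      let e : (ModuleCat.restrictScalars π).obj (ModuleCat.of S (N ⧸ U)) ≅ ModuleCat.of R (N ⧸ U) :=
        e.toModuleIso
      have := h (ModuleCat.of S (N ⧸ U))
      refine subsingleton_of_forall_eq 0 fun x => ?_
      have : x = (x.comp (Ext.mk₀ e.inv) (add_zero 1)).comp (Ext.mk₀ e.hom) (add_zero 1) := by
        simp
      rw [this, Subsingleton.elim (x.comp (Ext.mk₀ e.inv) (add_zero 1)) 0, Ext.zero_comp]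
    have hT := shortExact_ker U.mkQ U.mkQ_surjective
    have h₁' : Subsingleton (Ext M U.mkQ.shortComplexKer.X₁ 1) := by
      have hU : LinearMap.ker U.mkQ = U := U.ker_mkQ
      have e : U.mkQ.shortComplexKer.X₁ ≅ ModuleCat.of R U :=
        (LinearEquiv.ofEq _ _ hU).toModuleIso
      refine subsingleton_of_forall_eq 0 fun x => ?_
      have : x = (x.comp (Ext.mk₀ e.hom) (add_zero 1)).comp (Ext.mk₀ e.inv) (add_zero 1) := by
        simp
      rw [this, Subsingleton.elim (x.comp (Ext.mk₀ e.hom) (add_zero 1)) 0, Ext.zero_comp]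
    refine subsingleton_of_forall_eq 0 fun x => ?_
    obtain ⟨y, hy⟩ := Ext.covariant_sequence_exact₂ M hT x (h₂.elim _ _)
    exact hy.symm.trans (by rw [Subsingleton.elim y 0, Ext.zero_comp])

/-- The converse of the previous transfer rests on the projective case. If `F.obj M` is projective
and `M` is acyclic, then `Ext¹_R(M, X)` vanishes for each `S`-module `X`, hence, by nilpotency of
the kernel, for each `R`-module. -/
theorem hasProjectiveDimensionLT_of_leftAdjoint_restrictScalars {R S : Type u} [Ring R] [Ring S]
    (π : R →+* S) (ν : S →+* R) (hπν : ∀ s, π (ν s) = s) (hK : ∃ j, RingHom.ker π ^ j = ⊥)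
    {F : ModuleCat.{u} R ⥤ ModuleCat.{u} S} (adj : F ⊣ ModuleCat.restrictScalars π)
    [F.Additive] {Z : ModuleCat.{u} S} (hZ : IsCoseparator Z) (n : ℕ)
    (M : ModuleCat.{u} R) (hM : IsExtAcyclic ((ModuleCat.restrictScalars π).obj Z) M)
    (h : HasProjectiveDimensionLT (F.obj M) (n + 1)) : HasProjectiveDimensionLT M (n + 1) := by
  induction n generalizing M with
  | zero =>
    obtain ⟨T, hT, hP, rfl, -⟩ := exists_presentation False (by simp) M (by simp)
    have hFT := shortExact_map_leftAdjoint adj hZ hT (hM 1 le_rfl)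
    have hX : ∀ X : ModuleCat.{u} S,
        Subsingleton (Ext T.X₃ ((ModuleCat.restrictScalars π).obj X) 1) := by
      refine fun X => subsingleton_of_forall_eq 0 fun x => ?_
      -- The class `x` comes from a map `g` out of `T.X₁`. Its adjunct extends over `F.obj T.X₂`
      -- because `F.obj T.X₃` is projective, so `g` factors through `T.f` and the class is zero.
      obtain ⟨y, rfl⟩ := Ext.contravariant_sequence_exact₃ hT _ x (Ext.eq_zero_of_projective _)
        (add_comm 1 0)
      obtain ⟨g, rfl⟩ := Ext.homEquiv₀.symm.surjective y
      obtain ⟨g', hg'⟩ := exists_extension_of_ext_one hFT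
        (HasProjectiveDimensionLT.subsingleton (F.obj T.X₃) 1 1 le_rfl X)
        ((adj.homEquiv _ _).symm g)
      have hg : g = T.f ≫ adj.homEquiv _ _ g' := by
        refine Eq.trans ?_ (adj.homEquiv_naturality_left T.f g')
        exact ((adj.homEquiv _ _).symm_apply_eq.1 hg'.symm)
      rw [Ext.homEquiv₀_symm_apply, hg, ← Ext.mk₀_comp_mk₀, hT.extClass_comp_assoc]
    obtain ⟨j, hj⟩ := hK
    have : Projective T.X₃ := projective_iff_subsingleton_ext_one.2 fun N =>
      ext_one_subsingleton_of_nilpotent π ν hπν T.X₃ hX j N (by rw [hj]; simp)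
    exact inferInstanceAs (HasProjectiveDimensionLT T.X₃ 1)
  | succ n ih =>
    obtain ⟨T, hT, hP, rfl, -⟩ := exists_presentation False (by simp) M (by simp)
    have hFT := shortExact_map_leftAdjoint adj hZ hT (hM 1 le_rfl)
    have hFP := adj.map_projective T.X₂ inferInstance
    have h₁ := ih T.X₁ (fun i hi => ext_X₁_subsingleton hT _ i hi (hM _ (by omega)))
      (hFT.hasProjectiveDimensionLT_X₁ (n + 1)
        (inferInstanceAs (HasProjectiveDimensionLT (F.obj T.X₂) _)) h)
    exact hT.hasProjectiveDimensionLT_X₃ (n + 1) h₁ inferInstance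

end Homological

/-- The left module of characters of a right module. -/
def CharacterDual (R : Type u) [Ring R] (B : Type u) [AddCommGroup B] [Module Rᵐᵒᵖ B] : Type u :=
  CharacterModule B

/-! ### Character modules: right projective dimension as left injective dimension -/

namespace CharacterDual

open MulOpposite

variable {R : Type u} [Ring R] {B : Type u} [AddCommGroup B] [Module Rᵐᵒᵖ B]

instance : AddCommGroup (CharacterDual R B) := inferInstanceAs (AddCommGroup (CharacterModule B))

instance : FunLike (CharacterDual R B) B (AddCircle (1 : ℚ)) :=
  inferInstanceAs (FunLike (CharacterModule B) B (AddCircle (1 : ℚ)))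

@[ext] theorem ext {c c' : CharacterDual R B} (h : ∀ x, c x = c' x) : c = c' :=
  DFunLike.ext _ _ h

instance : AddMonoidHomClass (CharacterDual R B) B (AddCircle (1 : ℚ)) where
  map_add c := AddMonoidHom.map_add (show B →+ AddCircle (1 : ℚ) from c)
  map_zero c := AddMonoidHom.map_zero (show B →+ AddCircle (1 : ℚ) from c)

/-- The character with given underlying additive map. -/
def ofAddMonoidHom (c : B →+ AddCircle (1 : ℚ)) : CharacterDual R B := c

@[simp] theorem ofAddMonoidHom_apply (c : B →+ AddCircle (1 : ℚ)) (b : B) :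
    (ofAddMonoidHom c : CharacterDual R B) b = c b := rfl

@[simp] theorem add_apply (c c' : CharacterDual R B) (b : B) : (c + c') b = c b + c' b := rfl

@[simp] theorem zero_apply (b : B) : (0 : CharacterDual R B) b = 0 := rfl

instance : SMul R (CharacterDual R B) where
  smul r c := ofAddMonoidHom
    { toFun := fun b => c (op r • b)
      map_zero' := by simp
      map_add' := by simp }

@[simp] theorem smul_apply (r : R) (c : CharacterDual R B) (b : B) :
    (r • c) b = c (op r • b) := rfl

instance : Module R (CharacterDual R B) where
  one_smul c := by ext; simp
  mul_smul r s c := by ext; simp [mul_smul]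
  smul_zero r := by ext; simp
  smul_add r c c' := by ext; simp
  add_smul r s c := by ext; simp [add_smul]
  zero_smul c := by ext; simp

/-- The linear map between character modules induced by a linear map of right modules. -/
def map {B' : Type u} [AddCommGroup B'] [Module Rᵐᵒᵖ B'] (f : B →ₗ[Rᵐᵒᵖ] B') :
    CharacterDual R B' →ₗ[R] CharacterDual R B where
  toFun c := ofAddMonoidHom
    { toFun := fun b => c (f b)
      map_zero' := by simp
      map_add' := by simp }
  map_add' c c' := by ext; simp
  map_smul' r c := by ext; simp

@[simp] theorem map_apply {B' : Type u} [AddCommGroup B'] [Module Rᵐᵒᵖ B'] (f : B →ₗ[Rᵐᵒᵖ] B')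
    (c : CharacterDual R B') (b : B) : map f c b = c (f b) := rfl

theorem exists_extension {A A' : Type u} [AddCommGroup A] [AddCommGroup A'] (f : A →+ A')
    (hf : Function.Injective f) (c : A →+ AddCircle (1 : ℚ)) :
    ∃ c' : A' →+ AddCircle (1 : ℚ), ∀ a, c' (f a) = c a := by
  obtain ⟨c', hc'⟩ := CharacterModule.dual_surjective_of_injective (f.toIntLinearMap) hf c
  exact ⟨c', fun a => DFunLike.congr_fun hc' a⟩

/-- `B` is a retract of a free right module. The dual of a free module is coinduced, so maps into it
amount to families of additive characters, and these extend because `ℚ/ℤ` is divisible. -/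
theorem injective_of_projective [Module.Projective Rᵐᵒᵖ B] :
    Module.Injective R (CharacterDual R B) := by
  refine ⟨fun X P _ _ _ _ f hf g => ?_⟩
  obtain ⟨s, hs⟩ := Module.projective_def'.1 (inferInstance : Module.Projective Rᵐᵒᵖ B)
  have hH : ∀ j : B, ∃ c : P →+ AddCircle (1 : ℚ), ∀ x, c (f x) = g x j := fun j =>
    exists_extension f.toAddMonoidHom hf
      { toFun := fun x => g x j
        map_zero' := by simp
        map_add' := by simp }
  choose H hH using hH
  -- `φ` is the `R`-linear map from `P` to the dual of the free module corresponding to the extended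
  -- characters `H j`. Composing with the splitting `s` lands in the dual of `B`.
  let φ : P → (B →₀ Rᵐᵒᵖ) →+ AddCircle (1 : ℚ) := fun p => Finsupp.liftAddHom fun j =>
    { toFun := fun r => H j (r.unop • p)
      map_zero' := by simp
      map_add' := by simp [add_smul] }
  have hφ : ∀ p j r, φ p (Finsupp.single j r) = H j (r.unop • p) := fun p j r => by simp [φ]
  have h₁ : ∀ p p' z, φ (p + p') z = φ p z + φ p' z := by
    intro p p' z
    induction z using Finsupp.induction_linear with
    | zero => simp
    | add z z' hz hz' => simp only [map_add, hz, hz']; abel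
    | single j r => simp [hφ]
  have h₂ : ∀ (r : R) p z, φ (r • p) z = φ p (op r • z) := by
    intro r p z
    induction z using Finsupp.induction_linear with
    | zero => simp
    | add z z' hz hz' => simp only [map_add, smul_add, hz, hz']
    | single j r => rw [hφ, Finsupp.smul_single, hφ]; simp [mul_smul]
  refine ⟨{ toFun := fun p => ofAddMonoidHom ((φ p).comp s.toAddMonoidHom),
            map_add' := fun p p' => by ext b; simp [h₁],
            map_smul' := fun r p => by ext b; simp [h₂] }, fun x => ?_⟩
  ext b
  have h₃ : ∀ z : B →₀ Rᵐᵒᵖ, φ (f x) z = g x (Finsupp.linearCombination Rᵐᵒᵖ id z) := by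
    intro z
    induction z using Finsupp.induction_linear with
    | zero => simp
    | add z z' hz hz' => simp only [map_add, hz, hz']
    | single j r => rw [hφ, ← map_smul, hH]; simp
  have h₄ : Finsupp.linearCombination Rᵐᵒᵖ id (s b) = b := LinearMap.congr_fun hs b
  exact (h₃ (s b)).trans (by rw [h₄])

/-- Dualizing turns projective dimension of right modules into injective dimension of left
modules. -/
theorem hasInjectiveDimensionLT (n : ℕ) (B : ModuleCat.{u} Rᵐᵒᵖ)
    (h : HasProjectiveDimensionLT B (n + 1)) :
    HasInjectiveDimensionLT (ModuleCat.of R (CharacterDual R B)) (n + 1) := by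
  induction n generalizing B with
  | zero =>
    have : Projective B := projective_iff_hasProjectiveDimensionLT_one.2 h
    have : Module.Projective Rᵐᵒᵖ B := inferInstance
    have := injective_of_projective (R := R) (B := B)
    have : Injective (ModuleCat.of R (CharacterDual R B)) :=
      Module.injective_object_of_injective_module R _
    exact inferInstanceAs (HasInjectiveDimensionLT _ 1)
  | succ n ih =>
    obtain ⟨T, hT, hP, rfl, -⟩ := exists_presentation False (by simp) B (by simp)
    have h₁ := ih T.X₁ (hT.hasProjectiveDimensionLT_X₁ (n + 1) inferInstance h)
    have h₂ := injective_of_projective (R := R) (B := T.X₂)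
    have : Injective (ModuleCat.of R (CharacterDual R T.X₂)) :=
      Module.injective_object_of_injective_module R _
    have hT' := hT.moduleCat_injective_f
    have hT'' := hT.moduleCat_surjective_g
    let D : ShortComplex (ModuleCat.{u} R) :=
      ShortComplex.moduleCatMk (map (R := R) T.g.hom) (map (R := R) T.f.hom) (by
        ext c x
        have := T.moduleCat_zero_apply x
        simp [this])
    have hD : D.ShortExact :=
      { exact := by
          rw [ShortComplex.moduleCat_exact_iff]
          intro c hc
          have hc' : ∀ x, T.g x = 0 → (show CharacterDual R T.X₂ from c) x = 0 := by
            intro x hx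
            obtain ⟨y, rfl⟩ := (ShortComplex.moduleCat_exact_iff _).1 hT.exact x hx
            exact DFunLike.congr_fun (F := CharacterDual R T.X₁) hc y
          -- A character vanishing on the kernel of `T.g` descends along any set-theoretic section
          -- `σ`. Its value does not depend on the chosen preimage, which also gives additivity.
          choose σ hσ using hT''
          have hσ' : ∀ x y, T.g x = y →
              (show CharacterDual R T.X₂ from c) (σ y) = (show CharacterDual R T.X₂ from c) x := by
            intro x y h
            rw [← sub_eq_zero, ← map_sub]
            exact hc' _ (by rw [map_sub, hσ, h, sub_self])
          refine ⟨ofAddMonoidHom (R := R) (B := T.X₃)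
            { toFun := fun y => (show CharacterDual R T.X₂ from c) (σ y)
              map_zero' := ?_
              map_add' := fun y y' => ?_ }, ?_⟩
          · rw [hσ' 0 0 (by simp), map_zero]
          · rw [hσ' (σ y + σ y') (y + y') (by rw [map_add, hσ, hσ]), map_add]
          · exact CharacterDual.ext (R := R) (B := T.X₂) fun x => hσ' x _ rfl
        mono_f := (ModuleCat.mono_iff_injective _).2 fun c c' h =>
          CharacterDual.ext (R := R) (B := T.X₃) fun y => by
            obtain ⟨x, rfl⟩ := hT'' y
            exact DFunLike.congr_fun (F := CharacterDual R T.X₂) h x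
        epi_g := (ModuleCat.epi_iff_surjective _).2 fun c => by
          obtain ⟨c', hc'⟩ := exists_extension T.f.hom.toAddMonoidHom hT'
            (show T.X₁ →+ AddCircle (1 : ℚ) from c)
          exact ⟨ofAddMonoidHom (R := R) (B := T.X₂) c',
            CharacterDual.ext (R := R) (B := T.X₁) hc'⟩ }
    have : Injective D.X₂ := this
    exact hD.hasInjectiveDimensionLT_X₁ (n + 1) h₁ inferInstance

variable (R) in
-- Each additive character of `Y` comes from an `R`-linear map to the dual of the regular right
-- module by evaluation at `1`, and characters separate points.
theorem isCoseparator : IsCoseparator (ModuleCat.of R (CharacterDual R R)) := by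
  rw [Preadditive.isCoseparator_iff]
  intro X Y f hf
  ext x
  refine CharacterModule.eq_zero_of_character_apply fun c => ?_
  let g : Y →ₗ[R] CharacterDual R R :=
    { toFun := fun y => ofAddMonoidHom
        { toFun := fun s => c (s • y)
          map_zero' := by simp
          map_add' := by simp [add_smul] }
      map_add' := fun y y' => by ext; simp
      map_smul' := fun r y => by ext; simp [mul_smul] }
  have := DFunLike.congr_fun (F := CharacterDual R R)
    (ConcreteCategory.congr_hom (hf (ModuleCat.ofHom g)) x) 1
  simpa [g] using this

/-- These Ext groups are the character duals of `Tor_i^R(S, M)`. They vanish above `c`, uniformly in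
`M`, because the coefficient module has injective dimension at most `c`. -/
theorem ext_restrictScalars_subsingleton {R S : Type u} [Ring R] [Ring S] (f : R →+* S) (c : ℕ)
    (h : HasProjectiveDimensionLT ((ModuleCat.restrictScalars f.op).obj (ModuleCat.of Sᵐᵒᵖ S))
      (c + 1)) (M : ModuleCat.{u} R) (i : ℕ) (hi : c + 1 ≤ i) :
    Subsingleton (Abelian.Ext M
      ((ModuleCat.restrictScalars f).obj (ModuleCat.of S (CharacterDual S S))) i) := by
  have h' := hasInjectiveDimensionLT c _ h
  let e : ((ModuleCat.restrictScalars f).obj (ModuleCat.of S (CharacterDual S S)) : ModuleCat R)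
      ≃ₗ[R] ModuleCat.of R (CharacterDual R
        ((ModuleCat.restrictScalars f.op).obj (ModuleCat.of Sᵐᵒᵖ S))) :=
    { AddEquiv.refl (CharacterModule S) with map_smul' := fun r x => rfl }
  have := e.toModuleIso.retract.hasInjectiveDimensionLT (c + 1)
  exact HasInjectiveDimensionLT.subsingleton _ (c + 1) i hi M

end CharacterDual

/-! ### Projective dimension along a split ring homomorphism -/

section Retraction

theorem exists_semilinear_lift {R S : Type u} [Ring R] [Ring S] (σ : R →+* S) {Y P X : Type u}
    [AddCommGroup Y] [Module R Y] [Module.Projective R Y] [AddCommGroup P] [Module S P]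
    [AddCommGroup X] [Module S X] (g : P →ₗ[S] X) (hg : Function.Surjective g) (a : Y →ₛₗ[σ] X) :
    ∃ c : Y →ₛₗ[σ] P, ∀ y, g (c y) = a y := by
  let : Module R P := Module.compHom P σ
  let : Module R X := Module.compHom X σ
  let g' : P →ₗ[R] X := { g with map_smul' := fun r x => g.map_smul (σ r) x }
  let a' : Y →ₗ[R] X := { a with map_smul' := fun r x => a.map_smulₛₗ r x }
  obtain ⟨c, hc⟩ := Module.projective_lifting_property g' a' hg
  exact ⟨{ c with map_smul' := fun r y => c.map_smul r y }, fun y => LinearMap.congr_fun hc y⟩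

/-- If a module `X` over a retract `S` of `R` is, up to maps factoring through projective modules,
a semilinear retract of the `R`-module `Y`, then its projective dimension is at most the one
of `Y`. -/
theorem hasProjectiveDimensionLT_of_stable_retract {R S : Type u} [Ring R] [Ring S] (π : R →+* S)
    (ν : S →+* R) (hπν : ∀ s, π (ν s) = s) (n : ℕ) {X Y T : Type u}
    [AddCommGroup X] [Module S X] [AddCommGroup Y] [Module R Y] [AddCommGroup T] [Module S T]
    [Module.Projective S T] (a : Y →ₛₗ[π] X) (b : X →ₛₗ[ν] Y) (s : X →ₗ[S] T) (t : T →ₗ[S] X)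
    (h : ∀ x, x = a (b x) + t (s x))
    (hY : HasProjectiveDimensionLT (ModuleCat.of R Y) (n + 1)) :
    HasProjectiveDimensionLT (ModuleCat.of S X) (n + 1) := by
  induction n generalizing X Y T with
  | zero =>
    have : Projective (ModuleCat.of R Y) := projective_iff_hasProjectiveDimensionLT_one.2 hY
    have : Module.Projective R Y := ModuleCat.projective_of_module_projective (ModuleCat.of R Y)
    let g : (X →₀ S) →ₗ[S] X := Finsupp.linearCombination S id
    have hg : Function.Surjective g := Finsupp.linearCombination_id_surjective S X
    obtain ⟨c, hc⟩ := exists_semilinear_lift π g hg a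
    -- The lift `c` of `a` through the free cover makes `X` a direct summand of a projective module.
    let i : X →ₗ[S] (X →₀ S) × T :=
      { toFun := fun x => (c (b x), s x)
        map_add' := fun x x' => by simp
        map_smul' := fun r x => by simp [map_smulₛₗ, hπν] }
    have : Module.Projective S X := Module.Projective.of_split i (g.coprod t) (by
      ext x
      simp [i, hc, ← h x])
    have : Projective (ModuleCat.of S X) := ModuleCat.projective_of_categoryTheory_projective _
    exact projective_iff_hasProjectiveDimensionLT_one.1 this
  | succ n ih =>
    let gX : (X →₀ S) →ₗ[S] X := Finsupp.linearCombination S id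
    have hgX : Function.Surjective gX := Finsupp.linearCombination_id_surjective S X
    let gY : (Y →₀ R) →ₗ[R] Y := Finsupp.linearCombination R id
    have hgY : Function.Surjective gY := Finsupp.linearCombination_id_surjective R Y
    have hTX := shortExact_ker gX hgX
    have hTY := shortExact_ker gY hgY
    have hPX : Projective gX.shortComplexKer.X₂ :=
      ModuleCat.projective_of_categoryTheory_projective (ModuleCat.of S (X →₀ S))
    have hPY : Projective gY.shortComplexKer.X₂ :=
      ModuleCat.projective_of_categoryTheory_projective (ModuleCat.of R (Y →₀ R))
    refine hTX.hasProjectiveDimensionLT_X₃ (n + 1) ?_ inferInstance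
    have hY' := hTY.hasProjectiveDimensionLT_X₁ (n + 1) inferInstance hY
    obtain ⟨c, hc⟩ := exists_semilinear_lift π gX hgX
      ({ toFun := fun q => a (gY q)
         map_add' := fun x x' => by simp
         map_smul' := fun r x => by simp [map_smulₛₗ] } : (Y →₀ R) →ₛₗ[π] X)
    obtain ⟨d, hd⟩ := exists_semilinear_lift ν gY hgY
      ({ toFun := fun q => b (gX q)
         map_add' := fun x x' => by simp
         map_smul' := fun r x => by simp [map_smulₛₗ] } : (X →₀ S) →ₛₗ[ν] Y)
    obtain ⟨e, he⟩ := Module.projective_lifting_property gX t hgX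
    have hc' : ∀ q, gX (c q) = a (gY q) := hc
    have hd' : ∀ q, gY (d q) = b (gX q) := hd
    have he' : ∀ q, gX (e q) = t q := fun q => LinearMap.congr_fun he q
    let a' : LinearMap.ker gY →ₛₗ[π] LinearMap.ker gX :=
      { toFun := fun y => ⟨c y, by rw [LinearMap.mem_ker, hc', y.2, map_zero]⟩
        map_add' := fun x x' => by ext1; simp
        map_smul' := fun r x => by ext1; simp [map_smulₛₗ] }
    let b' : LinearMap.ker gX →ₛₗ[ν] LinearMap.ker gY :=
      { toFun := fun x => ⟨d x, by rw [LinearMap.mem_ker, hd', x.2, map_zero]⟩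
        map_add' := fun x x' => by ext1; simp
        map_smul' := fun r x => by ext1; simp [map_smulₛₗ] }
    -- The lifts `c` and `d` induce maps between the syzygies whose composite is no longer the
    -- identity, but the error factors through the free module `X →₀ S`. On the kernel of `gX` the
    -- term with `e` vanishes, so the hypothesis of the induction holds with the inclusion as new
    -- `s`. This is why the statement allows a projective correction term.
    let t' : (X →₀ S) →ₗ[S] LinearMap.ker gX :=
      { toFun := fun x => ⟨x - c (d x) - e (s (gX x)), by
          rw [LinearMap.mem_ker, map_sub, map_sub, hc', hd', he']
          nth_rw 1 [h (gX x)]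
          abel⟩
        map_add' := fun x x' => by ext1; simp only [map_add, Submodule.coe_add]; abel
        map_smul' := fun r x => by ext1; simp [map_smulₛₗ, hπν, smul_sub] }
    refine ih a' b' (LinearMap.ker gX).subtype t' (fun x => ?_) hY'
    ext1
    have hx : gX x = 0 := x.2
    simp [a', b', t', hx]

theorem hasProjectiveDimensionLT_of_semilinear_retract {R S : Type u} [Ring R] [Ring S]
    (π : R →+* S) (ν : S →+* R) (hπν : ∀ s, π (ν s) = s) (n : ℕ) {X Y : Type u}
    [AddCommGroup X] [Module S X] [AddCommGroup Y] [Module R Y] (a : Y →ₛₗ[π] X) (b : X →ₛₗ[ν] Y)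
    (h : ∀ x, a (b x) = x) (hY : HasProjectiveDimensionLT (ModuleCat.of R Y) (n + 1)) :
    HasProjectiveDimensionLT (ModuleCat.of S X) (n + 1) :=
  hasProjectiveDimensionLT_of_stable_retract π ν hπν n (T := PUnit) a b 0 0
    (fun x => by simp [h x]) hY

end Retraction

/-! ### Finiteness of homological dimensions -/

section Dimensions

theorem WithBot.iSup_lt_top_iff {ι : Type*} (f : ι → WithBot ℕ∞) :
    ⨆ i, f i < ⊤ ↔ ∃ n : ℕ, ∀ i, f i ≤ n := by
  constructor
  · intro h
    generalize hs : ⨆ i, f i = s at h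
    have hle : ∀ i, f i ≤ s := fun i => hs ▸ le_iSup f i
    induction s with
    | bot => exact ⟨0, fun i => (hle i).trans bot_le⟩
    | coe s =>
      induction s with
      | top => exact absurd h (lt_irrefl _)
      | coe n => exact ⟨n, hle⟩
  · rintro ⟨n, hn⟩
    refine (iSup_le hn).trans_lt ?_
    exact WithBot.coe_lt_coe.2 (ENat.natCast_lt_top n)

/-- The projective dimensions of the modules of finite projective dimension are bounded; if `p`
holds, then only finitely generated modules are considered. -/
def HasFinitisticBound (p : Prop) (R : Type u) [Ring R] : Prop :=
  ∃ n : ℕ, ∀ M : ModuleCat.{u} R, (p → Module.Finite R M) →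
    (∃ m, HasProjectiveDimensionLT M (m + 1)) → HasProjectiveDimensionLT M (n + 1)

/-- The projective dimensions of all modules are bounded. -/
def HasGlobalBound (R : Type u) [Ring R] : Prop :=
  ∃ n : ℕ, ∀ M : ModuleCat.{u} R, HasProjectiveDimensionLT M (n + 1)

theorem projectiveDimension_lt_top_iff {R : Type u} [Ring R] (M : ModuleCat.{u} R) :
    projectiveDimension M < ⊤ ↔ ∃ n, HasProjectiveDimensionLT M (n + 1) := by
  rw [lt_top_iff_ne_top, projectiveDimension_ne_top_iff]

theorem littleFinitisticDimension_lt_top_iff (R : Type u) [Ring R] :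
    littleFinitisticDimension R < ⊤ ↔ HasFinitisticBound True R := by
  simp only [littleFinitisticDimension, HasFinitisticBound, forall_const, iSup_psigma',
    WithBot.iSup_lt_top_iff, projectiveDimension_le_iff, PSigma.forall,
    projectiveDimension_lt_top_iff]

theorem bigFinitisticDimension_lt_top_iff (R : Type u) [Ring R] :
    bigFinitisticDimension R < ⊤ ↔ HasFinitisticBound False R := by
  simp only [bigFinitisticDimension, HasFinitisticBound, false_imp_iff, forall_const, iSup_psigma',
    WithBot.iSup_lt_top_iff, projectiveDimension_le_iff, PSigma.forall,
    projectiveDimension_lt_top_iff]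

theorem globalDimension_lt_top_iff (R : Type u) [Ring R] :
    globalDimension R < ⊤ ↔ HasGlobalBound R := by
  simp only [globalDimension, HasGlobalBound, WithBot.iSup_lt_top_iff, projectiveDimension_le_iff]

/-- The image of the unit generates `F.obj M` over `S`: the projection modulo its span `W` and the
zero map have the same adjunct, so they agree. Generators of `M` therefore give generators of `F.obj
M`. -/
theorem finite_leftAdjoint_restrictScalars {R S : Type u} [Ring R] [Ring S] (f : R →+* S)
    {F : ModuleCat.{u} R ⥤ ModuleCat.{u} S} (adj : F ⊣ ModuleCat.restrictScalars f)
    (M : ModuleCat.{u} R) [hM : Module.Finite R M] : Module.Finite S (F.obj M) := by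
  obtain ⟨s, hs⟩ := hM.fg_top
  let η : M → F.obj M := fun x => adj.unit.app M x
  have hη_add : ∀ x y, η (x + y) = η x + η y := fun x y => map_add (adj.unit.app M).hom x y
  have hη_smul : ∀ (r : R) x, η (r • x) = f r • η x := fun r x =>
    map_smul (adj.unit.app M).hom r x
  have hη_zero : η 0 = 0 := map_zero (adj.unit.app M).hom
  let W : Submodule S (F.obj M) := Submodule.span S (η '' s)
  have hW : ∀ x, η x ∈ W := by
    intro x
    have hx : x ∈ Submodule.span R (s : Set M) := hs ▸ Submodule.mem_top
    induction hx using Submodule.span_induction with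
    | mem x h => exact Submodule.subset_span ⟨x, h, rfl⟩
    | zero => rw [hη_zero]; exact W.zero_mem
    | add x y _ _ hx hy => rw [hη_add]; exact W.add_mem hx hy
    | smul r x _ hx => rw [hη_smul]; exact W.smul_mem _ hx
  have h : ModuleCat.ofHom W.mkQ = (0 : F.obj M ⟶ ModuleCat.of S (F.obj M ⧸ W)) := by
    apply (adj.homEquiv _ _).injective
    rw [adj.homEquiv_unit, adj.homEquiv_unit]
    ext x
    have h₁ : W.mkQ (η x) = 0 := by simpa using hW x
    exact h₁
  have hW' : W = ⊤ := by
    rw [← W.ker_mkQ, LinearMap.ker_eq_top]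
    exact congrArg ModuleCat.Hom.hom h
  exact ⟨hW' ▸ Submodule.fg_span (s.finite_toSet.image η)⟩

theorem finite_restrictScalars_of_surjective {R S : Type u} [Ring R] [Ring S] (f : R →+* S)
    (hf : Function.Surjective f) (X : ModuleCat.{u} S) [hX : Module.Finite S X] :
    Module.Finite R ((ModuleCat.restrictScalars f).obj X) := by
  obtain ⟨s, hs⟩ := hX.fg_top
  refine ⟨⟨s, ?_⟩⟩
  rw [eq_top_iff]
  intro (x : X) hx
  clear hx
  have hx : x ∈ Submodule.span S (s : Set X) := hs ▸ Submodule.mem_top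
  induction hx using Submodule.span_induction with
  | mem x h => exact Submodule.subset_span h
  | zero => exact Submodule.zero_mem _
  | add x y _ _ hx hy => exact Submodule.add_mem _ hx hy
  | smul r x _ hx =>
    obtain ⟨r, rfl⟩ := hf r
    exact Submodule.smul_mem _ r hx

theorem shortExact_restrictScalars {R S : Type u} [Ring R] [Ring S] (f : R →+* S)
    {T : ShortComplex (ModuleCat.{u} S)} (hT : T.ShortExact) :
    (T.map (ModuleCat.restrictScalars f)).ShortExact where
  exact := (ShortComplex.ShortExact.moduleCat_exact_iff_function_exact _).2
    ((ShortComplex.ShortExact.moduleCat_exact_iff_function_exact T).1 hT.exact)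
  mono_f := (ModuleCat.mono_iff_injective _).2 hT.moduleCat_injective_f
  epi_g := (ModuleCat.epi_iff_surjective _).2 hT.moduleCat_surjective_g

theorem projective_finsupp {R : Type u} [Ring R] (ι : Type u) (B : Type u) [AddCommGroup B]
    [Module R B] [Module.Projective R B] : Projective (ModuleCat.of R (ι →₀ B)) := by
  classical
  have : Module.Projective R (ι →₀ B) := Module.Projective.of_equiv (finsuppLequivDFinsupp R).symm
  exact ModuleCat.projective_of_categoryTheory_projective (ModuleCat.of R (ι →₀ B))

/-- Needed since the restriction of a free `S`-module to `R` is a direct sum of copies of `S`. -/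
theorem hasProjectiveDimensionLT_finsupp {R : Type u} [Ring R] (ι : Type u) (n : ℕ)
    (B : ModuleCat.{u} R) (h : HasProjectiveDimensionLT B (n + 1)) :
    HasProjectiveDimensionLT (ModuleCat.of R (ι →₀ B)) (n + 1) := by
  induction n generalizing B with
  | zero =>
    have : Projective B := projective_iff_hasProjectiveDimensionLT_one.2 h
    have : Module.Projective R B := inferInstance
    exact projective_iff_hasProjectiveDimensionLT_one.1
      (projective_finsupp ι B)
  | succ n ih =>
    obtain ⟨T, hT, hP, rfl, -⟩ := exists_presentation False (by simp) B (by simp)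
    have h₁ := ih T.X₁ (hT.hasProjectiveDimensionLT_X₁ (n + 1) inferInstance h)
    have hP' : Module.Projective R T.X₂ := inferInstance
    let D : ShortComplex (ModuleCat.{u} R) :=
      ShortComplex.moduleCatMk (Finsupp.mapRange.linearMap (α := ι) T.f.hom)
        (Finsupp.mapRange.linearMap (α := ι) T.g.hom) (by
          rw [← Finsupp.mapRange.linearMap_comp, ← ModuleCat.hom_comp, T.zero]
          ext; simp)
    have hD : D.ShortExact :=
      { exact := by
          rw [ShortComplex.moduleCat_exact_iff]
          intro z hz
          have hz' : ∀ i, T.g ((show ι →₀ T.X₂ from z) i) = 0 := fun i =>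
            DFunLike.congr_fun (F := ι →₀ T.X₃) hz i
          choose σ hσ using (ShortComplex.moduleCat_exact_iff _).1 hT.exact
          have hσ0 : σ 0 (map_zero T.g.hom) = 0 :=
            hT.moduleCat_injective_f (by rw [hσ, map_zero])
          classical
          refine ⟨Finsupp.onFinset (show ι →₀ T.X₂ from z).support
            (fun i => σ ((show ι →₀ T.X₂ from z) i) (hz' i)) ?_, ?_⟩
          · intro i hi
            rw [Finsupp.mem_support_iff]
            intro h0
            refine hi ?_
            apply hT.moduleCat_injective_f
            rw [hσ, map_zero, h0]
          · exact Finsupp.ext fun i => hσ _ (hz' i)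
        mono_f := (ModuleCat.mono_iff_injective _).2
          (Finsupp.mapRange_injective _ (map_zero T.f.hom) hT.moduleCat_injective_f)
        epi_g := (ModuleCat.epi_iff_surjective _).2
          (Finsupp.mapRange_surjective _ (map_zero T.g.hom) hT.moduleCat_surjective_g) }
    have : Projective D.X₂ :=
      projective_finsupp ι T.X₂
    exact hD.hasProjectiveDimensionLT_X₃ (n + 1) h₁ inferInstance

theorem hasProjectiveDimensionLT_restrictScalars_of_projective {R S : Type u} [Ring R] [Ring S]
    (f : R →+* S) (s : ℕ)
    (h : HasProjectiveDimensionLT ((ModuleCat.restrictScalars f).obj (ModuleCat.of S S)) (s + 1))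
    (X : ModuleCat.{u} S) [Projective X] :
    HasProjectiveDimensionLT ((ModuleCat.restrictScalars f).obj X) (s + 1) := by
  have : Module.Projective S X := inferInstance
  obtain ⟨i, hi⟩ := Module.projective_def'.1 this
  have h' := hasProjectiveDimensionLT_finsupp X s _ h
  let r : Retract ((ModuleCat.restrictScalars f).obj X)
      ((ModuleCat.restrictScalars f).obj (ModuleCat.of S (X →₀ S))) :=
    Retract.map ⟨ModuleCat.ofHom i, ModuleCat.ofHom (Finsupp.linearCombination S id),
      ModuleCat.hom_ext hi⟩ (ModuleCat.restrictScalars f)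
  let e : (ModuleCat.of R (X →₀ (ModuleCat.restrictScalars f).obj (ModuleCat.of S S))) ≃ₗ[R]
    ((ModuleCat.restrictScalars f).obj (ModuleCat.of S (X →₀ S)) : ModuleCat R) :=
    { AddEquiv.refl (X →₀ S) with map_smul' := fun r x => rfl }
  have := hasProjectiveDimensionLT_of_iso e.toModuleIso (s + 1)
  exact r.hasProjectiveDimensionLT (s + 1)

/-- The classical change of rings bound `pd_R X ≤ pd_S X + pd_R S`. -/
theorem hasProjectiveDimensionLT_restrictScalars {R S : Type u} [Ring R] [Ring S] (f : R →+* S)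
    (s : ℕ) (h : HasProjectiveDimensionLT ((ModuleCat.restrictScalars f).obj (ModuleCat.of S S))
      (s + 1)) (m : ℕ) (X : ModuleCat.{u} S) (hX : HasProjectiveDimensionLT X (m + 1)) :
    HasProjectiveDimensionLT ((ModuleCat.restrictScalars f).obj X) (m + s + 1) := by
  induction m generalizing X with
  | zero =>
    have : Projective X := projective_iff_hasProjectiveDimensionLT_one.2 hX
    rw [zero_add]
    exact hasProjectiveDimensionLT_restrictScalars_of_projective f s h X
  | succ m ih =>
    obtain ⟨T, hT, hP, rfl, -⟩ := exists_presentation False (by simp) X (by simp)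
    have h₁ := ih T.X₁ (hT.hasProjectiveDimensionLT_X₁ (m + 1) inferInstance hX)
    have h₂ := hasProjectiveDimensionLT_restrictScalars_of_projective f s h T.X₂
    have := (shortExact_restrictScalars f hT).hasProjectiveDimensionLT_X₃ (m + s + 1) h₁
      (hasProjectiveDimensionLT_of_ge ((ModuleCat.restrictScalars f).obj T.X₂) (s + 1)
        (m + s + 1 + 1) (by omega))
    rw [show m + 1 + s + 1 = m + s + 1 + 1 by omega]
    exact this

end Dimensions

/-! ### Comparison of the dimensions of `R` and `S` along a split surjection with kernel `K` -/

section SplitExtension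

open MulOpposite

theorem projective_of_ring (R : Type u) [Ring R] : Projective (ModuleCat.of R R) :=
  ModuleCat.projective_of_categoryTheory_projective _

theorem projective_of_op_ring (R : Type u) [Ring R] : Projective (ModuleCat.of Rᵐᵒᵖ R) := by
  let e : Rᵐᵒᵖ ≃ₗ[Rᵐᵒᵖ] R := { opAddEquiv.symm with map_smul' := fun r x => rfl }
  have := Module.Projective.of_equiv e
  exact ModuleCat.projective_of_categoryTheory_projective _

theorem hasProjectiveDimensionLT_of_ker {R : Type u} [Ring R] {P M K : Type u} [AddCommGroup P]
    [AddCommGroup M] [AddCommGroup K] [Module R P] [Module R M] [Module R K] (g : P →ₗ[R] M)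
    (hg : Function.Surjective g) (e : K ≃ₗ[R] LinearMap.ker g) (c : ℕ)
    (hK : HasProjectiveDimensionLT (ModuleCat.of R K) (c + 1))
    (hP : HasProjectiveDimensionLT (ModuleCat.of R P) (c + 2)) :
    HasProjectiveDimensionLT (ModuleCat.of R M) (c + 2) :=
  (shortExact_ker g hg).hasProjectiveDimensionLT_X₃ (c + 1)
    (hasProjectiveDimensionLT_of_iso (X' := ModuleCat.of R (LinearMap.ker g)) e.toModuleIso (c + 1))
    hP

variable {R S : Type u} [Ring R] [Ring S] (π : R →+* S) (ν : S →+* R)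
  (hπν : ∀ s, π (ν s) = s) (K : TwoSidedIdeal R) (hK : ∀ x, x ∈ K ↔ π x = 0)

include hπν hK

theorem hasProjectiveDimensionLT_quotient (c : ℕ)
    (h : HasProjectiveDimensionLT (ModuleCat.of R K) (c + 1)) :
    HasProjectiveDimensionLT ((ModuleCat.restrictScalars π).obj (ModuleCat.of S S)) (c + 2) := by
  let g : R →ₗ[R] (ModuleCat.restrictScalars π).obj (ModuleCat.of S S) :=
    { toFun := fun r => π r
      map_add' := fun x y => map_add π x y
      map_smul' := fun x y => map_mul π x y }
  let e : K ≃ₗ[R] LinearMap.ker g :=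
    { toFun := fun x => ⟨x, (hK x).1 x.2⟩
      invFun := fun x => ⟨x, (hK x).2 x.2⟩
      left_inv := fun x => rfl
      right_inv := fun x => rfl
      map_add' := fun x y => rfl
      map_smul' := fun r x => rfl }
  have := projective_of_ring R
  exact hasProjectiveDimensionLT_of_ker g (fun s => ⟨ν s, hπν s⟩) e c h
    (hasProjectiveDimensionLT_of_ge _ 1 _ (by omega))

theorem hasProjectiveDimensionLT_op_quotient (c : ℕ)
    (h : HasProjectiveDimensionLT (ModuleCat.of Rᵐᵒᵖ K) (c + 1)) :
    HasProjectiveDimensionLT ((ModuleCat.restrictScalars π.op).obj (ModuleCat.of Sᵐᵒᵖ S))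
      (c + 2) := by
  let g : R →ₗ[Rᵐᵒᵖ] (ModuleCat.restrictScalars π.op).obj (ModuleCat.of Sᵐᵒᵖ S) :=
    { toFun := fun r => π r
      map_add' := fun x y => map_add π x y
      map_smul' := fun x y => map_mul π y x.unop }
  let e : K ≃ₗ[Rᵐᵒᵖ] LinearMap.ker g :=
    { toFun := fun x => ⟨x, (hK x).1 x.2⟩
      invFun := fun x => ⟨x, (hK x).2 x.2⟩
      left_inv := fun x => rfl
      right_inv := fun x => rfl
      map_add' := fun x y => rfl
      map_smul' := fun r x => rfl }
  have := projective_of_op_ring R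
  exact hasProjectiveDimensionLT_of_ker g (fun s => ⟨ν s, hπν s⟩) e c h
    (hasProjectiveDimensionLT_of_ge _ 1 _ (by omega))

/-- The right module `S = R/K` has projective dimension at most one more than `K`. The resulting `c`
does not depend on `M`. -/
theorem exists_ext_vanishing_of_right_pd
    (h : projectiveDimension (ModuleCat.of Rᵐᵒᵖ K) < ⊤) :
    ∃ c, ∀ (M : ModuleCat.{u} R) (i : ℕ), c + 1 ≤ i → Subsingleton (Abelian.Ext M
      ((ModuleCat.restrictScalars π).obj (ModuleCat.of S (CharacterDual S S))) i) := by
  obtain ⟨c, hc⟩ := (projectiveDimension_lt_top_iff _).1 h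
  exact ⟨c + 1, CharacterDual.ext_restrictScalars_subsingleton π (c + 1)
    (hasProjectiveDimensionLT_op_quotient π ν hπν K hK c hc)⟩

/-- If the nilpotent kernel of a split surjection has finite projective dimension as a right module,
then finiteness of the finitistic dimension lifts along the surjection. -/
theorem HasFinitisticBound.of_quotient (p : Prop) (hR : p → IsNoetherianRing R)
    (hnil : ∃ j, RingHom.ker π ^ j = ⊥) (h : projectiveDimension (ModuleCat.of Rᵐᵒᵖ K) < ⊤)
    (hS : HasFinitisticBound p S) : HasFinitisticBound p R := by
  obtain ⟨c, hc⟩ := exists_ext_vanishing_of_right_pd π ν hπν K hK h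
  obtain ⟨n, hn⟩ := hS
  have := isRightAdjoint_restrictScalars π
  let adj := Adjunction.ofIsRightAdjoint (ModuleCat.restrictScalars.{u} π)
  have : (ModuleCat.restrictScalars.{u} π).leftAdjoint.Additive := adj.left_adjoint_additive
  refine ⟨n + c, fun M hM ⟨m, hm⟩ => ?_⟩
  obtain ⟨Y, hY, hYZ, h₁, h₂⟩ := exists_isExtAcyclic_syzygy p hR _ c M hM (hc M)
  -- Acyclicity of `Y` makes the projective dimension of `S ⊗_R Y` finite, so it is at most `n`.
  -- This bound lifts to `Y`, and to `M` with the extra `c`.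
  refine h₂ n (hasProjectiveDimensionLT_of_leftAdjoint_restrictScalars π ν hπν hnil adj
    (CharacterDual.isCoseparator S) n Y hYZ (hn _ (fun hp => ?_) ⟨m, ?_⟩))
  · have := hY hp
    exact finite_leftAdjoint_restrictScalars π adj Y
  · exact hasProjectiveDimensionLT_map_leftAdjoint adj (CharacterDual.isCoseparator S) m Y hYZ
      (h₁ m hm)

theorem HasGlobalBound.of_quotient (hnil : ∃ j, RingHom.ker π ^ j = ⊥)
    (h : projectiveDimension (ModuleCat.of Rᵐᵒᵖ K) < ⊤) (hS : HasGlobalBound S) :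
    HasGlobalBound R := by
  obtain ⟨c, hc⟩ := exists_ext_vanishing_of_right_pd π ν hπν K hK h
  obtain ⟨n, hn⟩ := hS
  have := isRightAdjoint_restrictScalars π
  let adj := Adjunction.ofIsRightAdjoint (ModuleCat.restrictScalars.{u} π)
  have : (ModuleCat.restrictScalars.{u} π).leftAdjoint.Additive := adj.left_adjoint_additive
  refine ⟨n + c, fun M => ?_⟩
  obtain ⟨Y, -, hYZ, -, h₂⟩ :=
    exists_isExtAcyclic_syzygy False (by simp) _ c M (by simp) (hc M)
  exact h₂ n (hasProjectiveDimensionLT_of_leftAdjoint_restrictScalars π ν hπν hnil adj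
    (CharacterDual.isCoseparator S) n Y hYZ (hn _))

omit hK K in
-- The identity map of `X` is semilinear along both `π` and `ν`, so `X` is a semilinear retract of
-- its restriction.
theorem hasProjectiveDimensionLT_of_restrictScalars (n : ℕ) (X : ModuleCat.{u} S)
    (h : HasProjectiveDimensionLT ((ModuleCat.restrictScalars π).obj X) (n + 1)) :
    HasProjectiveDimensionLT X (n + 1) := by
  let a : (ModuleCat.restrictScalars π).obj X →ₛₗ[π] X :=
    { toFun := fun x => x
      map_add' := fun x y => rfl
      map_smul' := fun r x => rfl }
  let b : X →ₛₗ[ν] (ModuleCat.restrictScalars π).obj X :=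
    { toFun := fun x => x
      map_add' := fun x y => rfl
      map_smul' := fun r (x : X) => show r • x = π (ν r) • x by rw [hπν] }
  exact hasProjectiveDimensionLT_of_semilinear_retract π ν hπν n a b (fun x => rfl) h

omit hK K in
theorem HasGlobalBound.of_split_extension (h : HasGlobalBound R) : HasGlobalBound S := by
  obtain ⟨n, hn⟩ := h
  exact ⟨n, fun X => hasProjectiveDimensionLT_of_restrictScalars π ν hπν n X (hn _)⟩

/-- The left projective dimension of `K` only ensures that restriction to `R` keeps projective
dimension finite. The bound `n` for `R` then serves unchanged for `S`. -/
theorem HasFinitisticBound.of_left_pd (p : Prop)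
    (h : projectiveDimension (ModuleCat.of R K) < ⊤) (hR : HasFinitisticBound p R) :
    HasFinitisticBound p S := by
  obtain ⟨c, hc⟩ := (projectiveDimension_lt_top_iff _).1 h
  obtain ⟨n, hn⟩ := hR
  refine ⟨n, fun X hX ⟨m, hm⟩ => hasProjectiveDimensionLT_of_restrictScalars π ν hπν n X
    (hn _ (fun hp => ?_) ⟨m + (c + 1), ?_⟩)⟩
  · have := hX hp
    exact finite_restrictScalars_of_surjective π (fun s => ⟨ν s, hπν s⟩) X
  · exact hasProjectiveDimensionLT_restrictScalars π (c + 1)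
      (hasProjectiveDimensionLT_quotient π ν hπν K hK c hc) m X hm

/-- As a right `S`-module along `ν`, `R` is an extension of the free module `S` by `K`. Because `K²
= 0`, the right `R`-action on `K` factors through `S`, so the bound on `K` over `R` holds over `S`.
-/
theorem hasProjectiveDimensionLT_op_extension (c : ℕ) (hsq : ∀ x ∈ K, ∀ y ∈ K, x * y = 0)
    (h : HasProjectiveDimensionLT (ModuleCat.of Rᵐᵒᵖ K) (c + 1)) :
    HasProjectiveDimensionLT ((ModuleCat.restrictScalars ν.op).obj (ModuleCat.of Rᵐᵒᵖ R))
      (c + 1) := by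
  let : Module Sᵐᵒᵖ K := Module.compHom K ν.op
  have hX : HasProjectiveDimensionLT (ModuleCat.of Sᵐᵒᵖ K) (c + 1) := by
    let a : K →ₛₗ[π.op] K :=
      { toFun := fun x => x
        map_add' := fun x y => rfl
        -- The difference between `r` and `ν (π r)` lies in `K`, which is annihilated by `x ∈ K`.
        map_smul' := fun r x => Subtype.ext <| show (x : R) * r.unop = x * ν (π r.unop) by
          rw [← sub_eq_zero, ← mul_sub]
          exact hsq _ x.2 _ ((hK _).2 (by rw [map_sub, hπν, sub_self])) }
    let b : K →ₛₗ[ν.op] K :=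
      { toFun := fun x => x
        map_add' := fun x y => rfl
        map_smul' := fun r x => rfl }
    exact hasProjectiveDimensionLT_of_semilinear_retract π.op ν.op
      (fun s => unop_injective (hπν s.unop)) c a b (fun x => rfl) h
  let g : (ModuleCat.restrictScalars ν.op).obj (ModuleCat.of Rᵐᵒᵖ R) →ₗ[Sᵐᵒᵖ] S :=
    { toFun := fun r => π r
      map_add' := fun x y => map_add π x y
      map_smul' := fun s (x : R) => show π (x * ν s.unop) = π x * s.unop by rw [map_mul, hπν] }
  let e : K ≃ₗ[Sᵐᵒᵖ] LinearMap.ker g :=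
    { toFun := fun x => ⟨x.1, (hK _).1 x.2⟩
      invFun := fun x => ⟨x.1, (hK _).2 x.2⟩
      left_inv := fun x => rfl
      right_inv := fun x => rfl
      map_add' := fun x y => rfl
      map_smul' := fun r x => rfl }
  have hT := shortExact_ker g (fun s => ⟨ν s, hπν s⟩)
  have := projective_of_op_ring S
  exact hT.hasProjectiveDimensionLT_X₂ (c + 1)
    (hasProjectiveDimensionLT_of_iso (X' := ModuleCat.of Sᵐᵒᵖ (LinearMap.ker g)) e.toModuleIso
      (c + 1)) (hasProjectiveDimensionLT_of_ge (ModuleCat.of Sᵐᵒᵖ S) 1 _ (by omega))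

/-- Restriction along `π` need not preserve finite projective dimension here, so scalars are
extended along `ν` instead. On a high syzygy `Y` this preserves projective dimension bounds, and `Y`
is recovered as a retract because `S ⊗_R (R ⊗_S Y)` is `Y`. -/
theorem HasFinitisticBound.of_square_zero (p : Prop) (hSN : p → IsNoetherianRing S)
    (hsq : ∀ x ∈ K, ∀ y ∈ K, x * y = 0) (h : projectiveDimension (ModuleCat.of Rᵐᵒᵖ K) < ⊤)
    (hR : HasFinitisticBound p R) : HasFinitisticBound p S := by
  obtain ⟨c, hc⟩ := (projectiveDimension_lt_top_iff _).1 h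
  obtain ⟨n, hn⟩ := hR
  have hc' := CharacterDual.ext_restrictScalars_subsingleton ν c
    (hasProjectiveDimensionLT_op_extension π ν hπν K hK c hsq hc)
  have := isRightAdjoint_restrictScalars ν
  let adj := Adjunction.ofIsRightAdjoint (ModuleCat.restrictScalars.{u} ν)
  let F := (ModuleCat.restrictScalars.{u} ν).leftAdjoint
  have : F.Additive := adj.left_adjoint_additive
  refine ⟨n + c, fun X hX ⟨m, hm⟩ => ?_⟩
  obtain ⟨Y, hY, hYZ, h₁, h₂⟩ := exists_isExtAcyclic_syzygy p hSN _ c X hX (hc' X)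
  refine h₂ n ?_
  let j' : Y →ₗ[S]
      ((ModuleCat.restrictScalars ν).obj ((ModuleCat.restrictScalars π).obj Y) : ModuleCat S) :=
    { toFun := fun x => x
      map_add' := fun x y => rfl
      map_smul' := fun r (x : Y) => show r • x = π (ν r) • x by rw [hπν] }
  let j : Y ⟶ (ModuleCat.restrictScalars ν).obj ((ModuleCat.restrictScalars π).obj Y) :=
    show Y ⟶ ModuleCat.of S ((ModuleCat.restrictScalars ν).obj
      ((ModuleCat.restrictScalars π).obj Y)) from ModuleCat.ofHom j'
  -- In tensor notation `k` sends `r ⊗ y` to `π r • y`. It retracts the unit `η`, which sends `y` to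
  -- `1 ⊗ y`.
  let k : F.obj Y ⟶ (ModuleCat.restrictScalars π).obj Y := (adj.homEquiv _ _).symm j
  let η : Y ⟶ (ModuleCat.restrictScalars ν).obj (F.obj Y) := adj.unit.app Y
  have hk : η ≫ (ModuleCat.restrictScalars ν).map k = j := by
    rw [← adj.homEquiv_unit, Equiv.apply_symm_apply]
  let a : F.obj Y →ₛₗ[π] Y :=
    { toFun := fun x => k x
      map_add' := fun x y => map_add k.hom x y
      map_smul' := fun r x => map_smul k.hom r x }
  let b : Y →ₛₗ[ν] F.obj Y :=
    { toFun := fun x => η x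
      map_add' := fun x y => map_add η.hom x y
      map_smul' := fun r x => map_smul η.hom r x }
  refine hasProjectiveDimensionLT_of_semilinear_retract π ν hπν n a b
    (fun x => ConcreteCategory.congr_hom hk x) (hn (F.obj Y) (fun hp => ?_) ⟨m, ?_⟩)
  · have := hY hp
    exact finite_leftAdjoint_restrictScalars ν adj Y
  · exact hasProjectiveDimensionLT_map_leftAdjoint adj (CharacterDual.isCoseparator R) m Y hYZ
      (h₁ m hm)

theorem hasFinitisticBound_iff (p : Prop) (hRN : p → IsNoetherianRing R)
    (hSN : p → IsNoetherianRing S) (hnil : ∃ j, RingHom.ker π ^ j = ⊥)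
    (h : projectiveDimension (ModuleCat.of Rᵐᵒᵖ K) < ⊤)
    (h' : projectiveDimension (ModuleCat.of R K) < ⊤ ∨ ∀ x ∈ K, ∀ y ∈ K, x * y = 0) :
    HasFinitisticBound p R ↔ HasFinitisticBound p S := by
  refine ⟨fun hR => ?_, HasFinitisticBound.of_quotient π ν hπν K hK p hRN hnil h⟩
  rcases h' with h' | h'
  · exact HasFinitisticBound.of_left_pd π ν hπν K hK p h' hR
  · exact HasFinitisticBound.of_square_zero π ν hπν K hK p hSN h' h hR

theorem hasGlobalBound_iff (hnil : ∃ j, RingHom.ker π ^ j = ⊥)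
    (h : projectiveDimension (ModuleCat.of Rᵐᵒᵖ K) < ⊤) :
    HasGlobalBound R ↔ HasGlobalBound S :=
  ⟨HasGlobalBound.of_split_extension π ν hπν, HasGlobalBound.of_quotient π ν hπν K hK hnil h⟩

end SplitExtension

/-! ### Paths avoiding a set of arrows -/

section Paths

variable {V : Type v} [Quiver.{w} V]

theorem pathPassesThrough_comp (A : Set (Total V)) {a b c : V} (p : Path a b) (q : Path b c) :
    QuiverPath.pathPassesThrough A (p.comp q) ↔
      QuiverPath.pathPassesThrough A p ∨ QuiverPath.pathPassesThrough A q := by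
  induction q with
  | nil => simp [QuiverPath.pathPassesThrough]
  | cons q e ih => simp [QuiverPath.pathPassesThrough, ih, or_assoc]

theorem pathPassesThrough_union (A B : Set (Total V)) {a b : V} (p : Path a b) :
    QuiverPath.pathPassesThrough (A ∪ B) p ↔
      QuiverPath.pathPassesThrough A p ∨ QuiverPath.pathPassesThrough B p := by
  induction p with
  | nil => simp [QuiverPath.pathPassesThrough]
  | cons q e ih => simp only [QuiverPath.pathPassesThrough, ih, Set.mem_union]; tauto

theorem passesThrough_toAmbient (H : WideSubquiver V) (B : Set (Total V)) (p : QuiverPath H) :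
    (p.toAmbient H).PassesThrough B ↔ p.PassesThrough (restrictArrows H B) := by
  obtain ⟨a, b, p⟩ := p
  induction p with
  | nil => rfl
  | cons q e ih => exact or_congr ih Iff.rfl

theorem not_passesThrough_toAmbient (A : Set (Total V)) (p : QuiverPath (removeArrows A)) :
    ¬ (p.toAmbient (removeArrows A)).PassesThrough A := by
  obtain ⟨a, b, p⟩ := p
  induction p with
  | nil => exact id
  | cons q e ih => exact not_or.2 ⟨ih, e.2⟩

theorem exists_toAmbient_eq (A : Set (Total V)) (p : QuiverPath V) (hp : ¬ p.PassesThrough A) :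
    ∃ q : QuiverPath (removeArrows A), q.toAmbient (removeArrows A) = p := by
  obtain ⟨a, b, p⟩ := p
  suffices h : ∃ q : Path (V := removeArrows A) a b,
      (wideInclusion (removeArrows A)).mapPath q = p by
    obtain ⟨q, hq⟩ := h
    exact ⟨⟨a, b, q⟩, by rw [← hq]; rfl⟩
  induction p with
  | nil => exact ⟨.nil, rfl⟩
  | cons p e ih =>
    obtain ⟨h₁, h₂⟩ := not_or.1 hp
    obtain ⟨q, rfl⟩ := ih h₁
    exact ⟨Path.cons (V := removeArrows A) q ⟨e, h₂⟩, rfl⟩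

theorem length_pos_of_pathPassesThrough (A : Set (Total V)) (p : QuiverPath V)
    (hp : p.PassesThrough A) : 1 ≤ p.length := by
  obtain ⟨a, b, p⟩ := p
  cases p with
  | nil => exact hp.elim
  | cons p e => exact Nat.succ_le_succ (Nat.zero_le _)

theorem passesThrough_univ_of_length_pos (p : QuiverPath V) (hp : 1 ≤ p.length) :
    p.PassesThrough Set.univ := by
  obtain ⟨a, b, p⟩ := p
  cases p with
  | nil => exact absurd hp (by simp [QuiverPath.length])
  | cons p e => exact Or.inr trivial

end Paths

/-! ### The component avoiding `A` as an idempotent algebra endomorphism -/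

namespace PathAlgebra

variable {k : Type u} {V : Type v} [Field k] [Quiver.{w} V]

theorem avoiding_ofPath_of_passesThrough (A : Set (Total V)) (p : QuiverPath V)
    (hp : p.PassesThrough A) : avoiding A (ofPath p : PathAlgebra k V) = 0 := by
  simp [avoiding, coeff, ofPath, ofCoeff, Finsupp.filter_single_of_neg, hp]

theorem avoiding_ofPath_of_not_passesThrough (A : Set (Total V)) (p : QuiverPath V)
    (hp : ¬ p.PassesThrough A) : avoiding A (ofPath p : PathAlgebra k V) = ofPath p := by
  simp [avoiding, coeff, ofPath, ofCoeff, Finsupp.filter_single_of_pos, hp]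

theorem avoiding_add (A : Set (Total V)) (x y : PathAlgebra k V) :
    avoiding A (x + y) = avoiding A x + avoiding A y := by
  simp [avoiding, coeff, ofCoeff, Finsupp.filter_add]

theorem avoiding_smul (A : Set (Total V)) (c : k) (x : PathAlgebra k V) :
    avoiding A (c • x) = c • avoiding A x := by
  simp [avoiding, coeff, ofCoeff, Finsupp.filter_smul]

theorem avoiding_zero (A : Set (Total V)) : avoiding A (0 : PathAlgebra k V) = 0 := by
  simpa using avoiding_smul A (0 : k) (0 : PathAlgebra k V)

theorem through_eq_sub_avoiding (A : Set (Total V)) (z : PathAlgebra k V) :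
    through A z = z - avoiding A z := by
  classical
  rw [eq_sub_iff_add_eq, through, avoiding, ofCoeff, ofCoeff, ← map_add, Finsupp.filter_add_filter_not]
  exact basis.repr.symm_apply_apply z

theorem avoiding_avoiding (A B : Set (Total V)) (z : PathAlgebra k V) :
    avoiding B (avoiding A z) = avoiding (A ∪ B) z := by
  induction z using induction_on with
  | path p =>
    by_cases hA : p.PassesThrough A
    · rw [avoiding_ofPath_of_passesThrough A p hA, avoiding_zero,
        avoiding_ofPath_of_passesThrough _ p ((pathPassesThrough_union A B p.path).2 (Or.inl hA))]
    · rw [avoiding_ofPath_of_not_passesThrough A p hA]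
      by_cases hB : p.PassesThrough B
      · rw [avoiding_ofPath_of_passesThrough B p hB, avoiding_ofPath_of_passesThrough _ p
          ((pathPassesThrough_union A B p.path).2 (Or.inr hB))]
      · rw [avoiding_ofPath_of_not_passesThrough B p hB, avoiding_ofPath_of_not_passesThrough _ p
          (fun h => ((pathPassesThrough_union A B p.path).1 h).elim hA hB)]
  | add x y hx hy => simp only [avoiding_add, hx, hy]
  | smul c x hx => simp only [avoiding_smul, hx]
  | zero => simp only [avoiding_zero]

/-- A concatenation avoids `A` exactly when both factors do. This multiplicativity is the source of
all splittings used for the homological comparison. -/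
theorem avoiding_mul [Fintype V] (A : Set (Total V)) (x y : PathAlgebra k V) :
    avoiding A (x * y) = avoiding A x * avoiding A y := by
  induction x using induction_on with
  | path p =>
    induction y using induction_on with
    | path q =>
      obtain ⟨a, b, p⟩ := p
      obtain ⟨c, d, q⟩ := q
      rw [ofPath_mul_ofPath]
      by_cases h : b = c
      · subst h
        rw [pathMul_of_eq]
        by_cases hp : QuiverPath.pathPassesThrough A p
        · rw [avoiding_ofPath_of_passesThrough A ⟨a, b, p⟩ hp, zero_mul]
          exact avoiding_ofPath_of_passesThrough A _ ((pathPassesThrough_comp A p q).2 (Or.inl hp))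
        · rw [avoiding_ofPath_of_not_passesThrough A ⟨a, b, p⟩ hp]
          by_cases hq : QuiverPath.pathPassesThrough A q
          · rw [avoiding_ofPath_of_passesThrough A ⟨b, d, q⟩ hq, mul_zero]
            exact avoiding_ofPath_of_passesThrough A _
              ((pathPassesThrough_comp A p q).2 (Or.inr hq))
          · rw [avoiding_ofPath_of_not_passesThrough A ⟨b, d, q⟩ hq, ofPath_mul_ofPath,
              pathMul_of_eq]
            exact avoiding_ofPath_of_not_passesThrough A _
              (fun h => ((pathPassesThrough_comp A p q).1 h).elim hp hq)
      · rw [pathMul_of_ne h, avoiding_zero]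
        by_cases hp : QuiverPath.pathPassesThrough A p
        · rw [avoiding_ofPath_of_passesThrough A ⟨a, b, p⟩ hp, zero_mul]
        · rw [avoiding_ofPath_of_not_passesThrough A ⟨a, b, p⟩ hp]
          by_cases hq : QuiverPath.pathPassesThrough A q
          · rw [avoiding_ofPath_of_passesThrough A ⟨c, d, q⟩ hq, mul_zero]
          · rw [avoiding_ofPath_of_not_passesThrough A ⟨c, d, q⟩ hq, ofPath_mul_ofPath,
              pathMul_of_ne h]
    | add x y hx hy => simp only [mul_add, avoiding_add, hx, hy]
    | smul c x hx => simp only [mul_smul_comm, avoiding_smul, hx]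
    | zero => simp only [mul_zero, avoiding_zero]
  | add x y hx hy => simp only [add_mul, avoiding_add, hx, hy]
  | smul c x hx => simp only [smul_mul_assoc, avoiding_smul, hx]
  | zero => simp only [zero_mul, avoiding_zero]

/-- The endomorphism of the path algebra that annihilates the paths passing through `A`. -/
def avoidingHom (k : Type u) {V : Type v} [Field k] [Quiver.{w} V] [Fintype V]
    (A : Set (Total V)) : PathAlgebra k V →ₐ[k] PathAlgebra k V :=
  AlgHom.ofLinearMap
    { toFun := avoiding A
      map_add' := avoiding_add A
      map_smul' := avoiding_smul A }
    (by
      show avoiding A (1 : PathAlgebra k V) = 1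
      have h : ∀ s : Finset V,
          avoiding A (∑ a ∈ s, ofPath (QuiverPath.trivial a) : PathAlgebra k V) =
            ∑ a ∈ s, ofPath (QuiverPath.trivial a) := by
        classical
        intro s
        induction s using Finset.induction_on with
        | empty => exact avoiding_zero A
        | insert a s ha ih =>
          rw [Finset.sum_insert ha, avoiding_add, ih, avoiding_ofPath_of_not_passesThrough]
          exact id
      exact h Finset.univ)
    (avoiding_mul A)

@[simp] theorem avoidingHom_apply [Fintype V] (A : Set (Total V)) (z : PathAlgebra k V) :
    avoidingHom k A z = avoiding A z := rfl

theorem inclusion_ofPath [Fintype V] (H : WideSubquiver V) (p : QuiverPath H) :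
    inclusion k H (ofPath p) = ofPath (p.toAmbient H) := inclusionLin_ofPath k H p

theorem avoiding_inclusion [Fintype V] (H : WideSubquiver V) (B : Set (Total V))
    (z : PathAlgebra k H) :
    avoiding B (inclusion k H z) = inclusion k H (avoiding (restrictArrows H B) z) := by
  induction z using induction_on with
  | path p =>
    rw [inclusion_ofPath]
    by_cases hp : p.PassesThrough (restrictArrows H B)
    · rw [avoiding_ofPath_of_passesThrough _ p hp, map_zero,
        avoiding_ofPath_of_passesThrough _ _ ((passesThrough_toAmbient H B p).2 hp)]
    · rw [avoiding_ofPath_of_not_passesThrough _ p hp, inclusion_ofPath,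
        avoiding_ofPath_of_not_passesThrough _ _ (mt (passesThrough_toAmbient H B p).1 hp)]
  | add x y hx hy => simp only [map_add, avoiding_add, hx, hy]
  | smul c x hx => simp only [map_smul, avoiding_smul, hx]
  | zero => simp only [map_zero, avoiding_zero]

theorem avoiding_inclusion_self [Fintype V] (A : Set (Total V))
    (z : PathAlgebra k (removeArrows A)) :
    avoiding A (inclusion k (removeArrows A) z) = inclusion k (removeArrows A) z := by
  induction z using induction_on with
  | path p =>
    rw [inclusion_ofPath]
    exact avoiding_ofPath_of_not_passesThrough _ _ (not_passesThrough_toAmbient A p)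
  | add x y hx hy => simp only [map_add, avoiding_add, hx, hy]
  | smul c x hx => simp only [map_smul, avoiding_smul, hx]
  | zero => simp only [map_zero, avoiding_zero]

/-- Together with `avoiding_inclusion_self`, this identifies the path algebra of the smaller quiver
with the image of the idempotent endomorphism `avoiding A`. -/
theorem exists_inclusion_eq_avoiding [Fintype V] (A : Set (Total V)) (z : PathAlgebra k V) :
    ∃ z', inclusion k (removeArrows A) z' = avoiding A z := by
  induction z using induction_on with
  | path p =>
    by_cases hp : p.PassesThrough A
    · exact ⟨0, by rw [avoiding_ofPath_of_passesThrough A p hp, map_zero]⟩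
    · obtain ⟨q, hq⟩ := exists_toAmbient_eq A p hp
      exact ⟨ofPath q, by rw [inclusion_ofPath, hq, avoiding_ofPath_of_not_passesThrough A p hp]⟩
  | add x y hx hy =>
    obtain ⟨x', hx⟩ := hx
    obtain ⟨y', hy⟩ := hy
    exact ⟨x' + y', by rw [map_add, avoiding_add, hx, hy]⟩
  | smul c x hx =>
    obtain ⟨x', hx⟩ := hx
    exact ⟨c • x', by rw [map_smul, avoiding_smul, hx]⟩
  | zero => exact ⟨0, by rw [map_zero, avoiding_zero]⟩

end PathAlgebra

/-! ### Passing between canonical representations -/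

section Canonical

open PathAlgebra

variable {k : Type u} {V : Type v} [Field k] [Quiver.{w} V] [Fintype V]

/-- Since the two components add up to `z`, pre-removability says just that the endomorphism
`avoiding A` descends to `kQ / I`. -/
theorem isPreRemovable_iff (I : Ideal (PathAlgebra k V)) (A : Set (Total V)) :
    IsPreRemovable I A ↔ ∀ z ∈ I, avoiding A z ∈ I := by
  refine ⟨fun h z hz => (h z hz).2, fun h z hz => ⟨?_, h z hz⟩⟩
  rw [through_eq_sub_avoiding]
  exact I.sub_mem hz (h z hz)

theorem IsPreRemovable.union {I : Ideal (PathAlgebra k V)} {A B : Set (Total V)}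
    (hA : IsPreRemovable I A) (hB : IsPreRemovable I B) : IsPreRemovable I (A ∪ B) := by
  rw [isPreRemovable_iff] at *
  intro z hz
  rw [← avoiding_avoiding]
  exact hB _ (hA z hz)

omit [Fintype V] in
theorem avoiding_empty (z : PathAlgebra k V) : avoiding ∅ z = z := by
  induction z using induction_on with
  | path p =>
    refine avoiding_ofPath_of_not_passesThrough _ _ ?_
    obtain ⟨a, b, p⟩ := p
    induction p with
    | nil => exact id
    | cons p e ih => exact not_or.2 ⟨ih, id⟩
  | add x y hx hy => rw [avoiding_add, hx, hy]
  | smul c x hx => rw [avoiding_smul, hx]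
  | zero => rw [avoiding_zero]

theorem isPreRemovable_empty (I : Ideal (PathAlgebra k V)) : IsPreRemovable I ∅ := by
  rw [isPreRemovable_iff]
  intro z hz
  rwa [avoiding_empty]

/-- After removing a pre-removable set `U`, the set `B` becomes pre-removable if and only if
`U ∪ B` is pre-removable in the original algebra. -/
theorem isPreRemovable_canonicalIdeal_iff {I : Ideal (PathAlgebra k V)} {U B : Set (Total V)}
    (hU : IsPreRemovable I U) :
    IsPreRemovable (canonicalIdeal I U) (restrictArrows (removeArrows U) B) ↔
      IsPreRemovable I (U ∪ B) := by
  rw [isPreRemovable_iff, isPreRemovable_iff]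
  rw [isPreRemovable_iff] at hU
  constructor
  · intro h z hz
    obtain ⟨z', hz'⟩ := exists_inclusion_eq_avoiding U z
    rw [← avoiding_avoiding, ← hz', avoiding_inclusion]
    exact h z' (show inclusion k _ z' ∈ I by rw [hz']; exact hU z hz)
  · intro h z hz
    show inclusion k _ _ ∈ I
    rw [← avoiding_inclusion, ← avoiding_inclusion_self, avoiding_avoiding]
    exact h _ hz

variable (I : Ideal (PathAlgebra k V)) [I.IsTwoSided]

/-- The canonical representation of `(kQ / I) / ⟨A + I⟩` as a subring of `kQ / I`. -/
def canonicalInclusion (A : Set (Total V)) :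
    CanonicalRepresentation I A →+* PathAlgebra k V ⧸ I :=
  Ideal.quotientMap I (inclusion k (removeArrows A)).toRingHom le_rfl

@[simp] theorem canonicalInclusion_mk (A : Set (Total V)) (z : PathAlgebra k (removeArrows A)) :
    canonicalInclusion I A (Ideal.Quotient.mk _ z) =
      Ideal.Quotient.mk I (inclusion k (removeArrows A) z) := rfl

theorem canonicalInclusion_injective (A : Set (Total V)) :
    Function.Injective (canonicalInclusion I A) := by
  rw [injective_iff_map_eq_zero]
  intro x hx
  obtain ⟨z, rfl⟩ := Ideal.Quotient.mk_surjective x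
  rw [canonicalInclusion_mk, Ideal.Quotient.eq_zero_iff_mem] at hx
  exact Ideal.Quotient.eq_zero_iff_mem.2 hx

variable {I} in
/-- The endomorphism of `kQ / I` that annihilates the paths passing through `A`. -/
def avoidingQuotientHom {A : Set (Total V)} (hA : IsPreRemovable I A) :
    PathAlgebra k V ⧸ I →+* PathAlgebra k V ⧸ I :=
  Ideal.quotientMap I (avoidingHom k A).toRingHom (fun z hz => (hA z hz).2)

@[simp] theorem avoidingQuotientHom_mk {A : Set (Total V)} (hA : IsPreRemovable I A)
    (z : PathAlgebra k V) : avoidingQuotientHom hA (Ideal.Quotient.mk I z) =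
      Ideal.Quotient.mk I (avoiding A z) := rfl

theorem exists_canonicalInclusion_eq {A : Set (Total V)} (hA : IsPreRemovable I A)
    (x : PathAlgebra k V ⧸ I) : ∃ y, canonicalInclusion I A y = avoidingQuotientHom hA x := by
  obtain ⟨z, rfl⟩ := Ideal.Quotient.mk_surjective x
  obtain ⟨z', hz'⟩ := exists_inclusion_eq_avoiding A z
  exact ⟨Ideal.Quotient.mk _ z', by rw [canonicalInclusion_mk, hz', avoidingQuotientHom_mk]⟩

variable {I} in
/-- The projection of `kQ / I` onto the canonical representation of `(kQ / I) / ⟨A + I⟩`. -/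
def canonicalProjection {A : Set (Total V)} (hA : IsPreRemovable I A) :
    PathAlgebra k V ⧸ I →+* CanonicalRepresentation I A where
  -- The chosen preimage is unique because `canonicalInclusion` is injective, so each ring
  -- homomorphism law can be checked inside `kQ / I`.
  toFun x := (exists_canonicalInclusion_eq I hA x).choose
  map_one' := canonicalInclusion_injective I A <| by
    rw [(exists_canonicalInclusion_eq I hA _).choose_spec]; simp only [map_one]
  map_zero' := canonicalInclusion_injective I A <| by
    rw [(exists_canonicalInclusion_eq I hA _).choose_spec]; simp only [map_zero]
  map_add' x y := canonicalInclusion_injective I A <| by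
    rw [(exists_canonicalInclusion_eq I hA _).choose_spec, map_add, map_add,
      (exists_canonicalInclusion_eq I hA _).choose_spec,
      (exists_canonicalInclusion_eq I hA _).choose_spec]
  map_mul' x y := canonicalInclusion_injective I A <| by
    rw [(exists_canonicalInclusion_eq I hA _).choose_spec, map_mul, map_mul,
      (exists_canonicalInclusion_eq I hA _).choose_spec,
      (exists_canonicalInclusion_eq I hA _).choose_spec]

variable {I}

theorem canonicalInclusion_canonicalProjection {A : Set (Total V)} (hA : IsPreRemovable I A)
    (x : PathAlgebra k V ⧸ I) :
    canonicalInclusion I A (canonicalProjection hA x) = avoidingQuotientHom hA x :=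
  (exists_canonicalInclusion_eq I hA x).choose_spec

theorem avoidingQuotientHom_canonicalInclusion {A : Set (Total V)} (hA : IsPreRemovable I A)
    (x : CanonicalRepresentation I A) :
    avoidingQuotientHom hA (canonicalInclusion I A x) = canonicalInclusion I A x := by
  obtain ⟨z, rfl⟩ := Ideal.Quotient.mk_surjective x
  rw [canonicalInclusion_mk, avoidingQuotientHom_mk, avoiding_inclusion_self]

theorem avoidingQuotientHom_canonicalInclusion_of_subset {U W : Set (Total V)}
    (hU : IsPreRemovable I U) (hUW : U ⊆ W) (x : CanonicalRepresentation I W) :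
    avoidingQuotientHom hU (canonicalInclusion I W x) = canonicalInclusion I W x := by
  obtain ⟨z, rfl⟩ := Ideal.Quotient.mk_surjective x
  rw [canonicalInclusion_mk, avoidingQuotientHom_mk, ← avoiding_inclusion_self W,
    avoiding_avoiding, Set.union_eq_self_of_subset_right hUW]

theorem canonicalProjection_canonicalInclusion {A : Set (Total V)} (hA : IsPreRemovable I A)
    (x : CanonicalRepresentation I A) :
    canonicalProjection hA (canonicalInclusion I A x) = x :=
  canonicalInclusion_injective I A <| by
    rw [canonicalInclusion_canonicalProjection, avoidingQuotientHom_canonicalInclusion]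

variable (I) in
/-- The ring homomorphism from the canonical representation for `U` to the one for the
pre-removable set `W`, annihilating the paths that pass through `W`. -/
def transition (U : Set (Total V)) {W : Set (Total V)} (hW : IsPreRemovable I W) :
    CanonicalRepresentation I U →+* CanonicalRepresentation I W :=
  (canonicalProjection hW).comp (canonicalInclusion I U)

theorem canonicalInclusion_transition (U : Set (Total V)) {W : Set (Total V)}
    (hW : IsPreRemovable I W) (x : CanonicalRepresentation I U) :
    canonicalInclusion I W (transition I U hW x) =
      avoidingQuotientHom hW (canonicalInclusion I U x) :=
  canonicalInclusion_canonicalProjection hW _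

/-- For `U ⊆ W` the map from the `W`-stage back to the `U`-stage is inclusion of paths. Projection
and section are thus both instances of `transition`, and every stage is compared inside the one ring
`kQ / I`. -/
theorem canonicalInclusion_transition_of_subset {U W : Set (Total V)} (hU : IsPreRemovable I U)
    (hUW : U ⊆ W) (x : CanonicalRepresentation I W) :
    canonicalInclusion I U (transition I W hU x) = canonicalInclusion I W x := by
  rw [canonicalInclusion_transition, avoidingQuotientHom_canonicalInclusion_of_subset hU hUW]

theorem transition_transition_of_subset {U W : Set (Total V)} (hU : IsPreRemovable I U)
    (hW : IsPreRemovable I W) (hUW : U ⊆ W) (x : CanonicalRepresentation I W) :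
    transition I U hW (transition I W hU x) = x :=
  canonicalInclusion_injective I W <| by
    rw [canonicalInclusion_transition, canonicalInclusion_transition_of_subset hU hUW,
      avoidingQuotientHom_canonicalInclusion]

theorem transition_mk_smul_one (U : Set (Total V)) {W : Set (Total V)}
    (hW : IsPreRemovable I W) (c : k) :
    transition I U hW (Ideal.Quotient.mk _ (c • 1)) = Ideal.Quotient.mk _ (c • 1) := by
  apply canonicalInclusion_injective I W
  rw [canonicalInclusion_transition, canonicalInclusion_mk, canonicalInclusion_mk,
    avoidingQuotientHom_mk, map_smul, map_smul, map_one, map_one, avoiding_smul,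
    ← avoidingHom_apply, map_one]

omit [Fintype V] in
theorem passesThrough_ofArrow (A : Set (Total V)) (α : Total V) :
    (QuiverPath.ofArrow α).PassesThrough A ↔ α ∈ A :=
  ⟨fun h => h.elim False.elim id, Or.inr⟩

/-- An arrow of `B` goes to itself or, if it lies in `W`, to zero. No relation between `U` and `W`
is required, so this applies to the projection and to its section alike. -/
theorem transition_mem_arrowIdeal (U : Set (Total V)) {W : Set (Total V)}
    (hW : IsPreRemovable I W) (B : Set (Total V)) (x : CanonicalRepresentation I U)
    (hx : x ∈ arrowIdeal (canonicalIdeal I U) (restrictArrows (removeArrows U) B)) :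
    transition I U hW x ∈
      arrowIdeal (canonicalIdeal I W) (restrictArrows (removeArrows W) B) := by
  rw [← TwoSidedIdeal.mem_comap]
  refine (TwoSidedIdeal.span_le.2 ?_ :
    arrowIdeal (canonicalIdeal I U) (restrictArrows (removeArrows U) B) ≤ _) hx
  rintro _ ⟨α, hα, rfl⟩
  rw [SetLike.mem_coe, TwoSidedIdeal.mem_comap]
  let α' : Total V := ⟨(wideInclusion (removeArrows U)).obj α.left,
    (wideInclusion (removeArrows U)).obj α.right, (wideInclusion (removeArrows U)).map α.hom⟩
  have hα' : α' ∈ B := hα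
  have h₁ : canonicalInclusion I W (transition I U hW
      (Ideal.Quotient.mk (canonicalIdeal I U) (PathAlgebra.ofArrow α))) =
      Ideal.Quotient.mk I (avoiding W (PathAlgebra.ofArrow α')) := by
    rw [canonicalInclusion_transition, canonicalInclusion_mk, avoidingQuotientHom_mk]
    exact congrArg (fun z => Ideal.Quotient.mk I (avoiding W z))
      (inclusion_ofPath (removeArrows U) (QuiverPath.ofArrow α))
  by_cases hW' : α' ∈ W
  · have : transition I U hW
        (Ideal.Quotient.mk (canonicalIdeal I U) (PathAlgebra.ofArrow α)) = 0 := by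
      apply canonicalInclusion_injective I W
      rw [h₁, PathAlgebra.ofArrow, avoiding_ofPath_of_passesThrough W _
        ((passesThrough_ofArrow W α').2 hW'), map_zero, map_zero]
    rw [this]
    exact TwoSidedIdeal.zero_mem _
  · let β : Total (removeArrows W) := ⟨α'.left, α'.right, ⟨α'.hom, hW'⟩⟩
    have : transition I U hW (Ideal.Quotient.mk (canonicalIdeal I U) (PathAlgebra.ofArrow α)) =
        Ideal.Quotient.mk (canonicalIdeal I W) (PathAlgebra.ofArrow β) := by
      apply canonicalInclusion_injective I W
      rw [h₁, PathAlgebra.ofArrow, avoiding_ofPath_of_not_passesThrough W _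
        (mt (passesThrough_ofArrow W α').1 hW'), canonicalInclusion_mk]
      exact congrArg (Ideal.Quotient.mk I)
        (inclusion_ofPath (removeArrows W) (QuiverPath.ofArrow β)).symm
    rw [this]
    exact TwoSidedIdeal.subset_span ⟨β, hα', rfl⟩

omit [Fintype V] in
theorem ofPath_cons {a b c : V} (p : Path a b) (e : b ⟶ c) :
    (ofPath ⟨a, c, p.cons e⟩ : PathAlgebra k V) =
      ofPath ⟨a, b, p⟩ * PathAlgebra.ofArrow ⟨b, c, e⟩ := by
  rw [PathAlgebra.ofArrow, ofPath_mul_ofPath]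
  exact (pathMul_of_eq p e.toPath).symm

theorem ofPath_mem_arrowIdeal (A : Set (Total V)) (p : QuiverPath V) (hp : p.PassesThrough A) :
    Ideal.Quotient.mk I (ofPath p) ∈ arrowIdeal I A := by
  obtain ⟨a, b, p⟩ := p
  induction p with
  | nil => exact hp.elim
  | cons p e ih =>
    rw [ofPath_cons, map_mul]
    rcases hp with hp | hp
    · exact TwoSidedIdeal.mul_mem_right _ _ _ (ih hp)
    · exact TwoSidedIdeal.mul_mem_left _ _ _ (TwoSidedIdeal.subset_span ⟨_, hp, rfl⟩)

/-- The ideal generated by the arrows in `B` is the kernel of the projection that removes `B`. -/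
theorem mem_arrowIdeal_iff {U B : Set (Total V)} (hU : IsPreRemovable I U)
    (hUB : IsPreRemovable I (U ∪ B)) (x : CanonicalRepresentation I U) :
    x ∈ arrowIdeal (canonicalIdeal I U) (restrictArrows (removeArrows U) B) ↔
      transition I U hUB x = 0 := by
  constructor
  · intro hx
    rw [← TwoSidedIdeal.mem_ker]
    refine (TwoSidedIdeal.span_le.2 ?_ :
      arrowIdeal (canonicalIdeal I U) (restrictArrows (removeArrows U) B) ≤ _) hx
    rintro _ ⟨α, hα, rfl⟩
    rw [SetLike.mem_coe, TwoSidedIdeal.mem_ker]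
    apply canonicalInclusion_injective I (U ∪ B)
    rw [canonicalInclusion_transition, canonicalInclusion_mk, avoidingQuotientHom_mk, map_zero,
      PathAlgebra.ofArrow, inclusion_ofPath, avoiding_ofPath_of_passesThrough, map_zero]
    exact Or.inr (Or.inr hα)
  -- It is enough that `x` is congruent to its projected part modulo the ideal. This can be checked
  -- on paths: one through `B` lies in the ideal together with its image, and one avoiding `B` is
  -- fixed.
  · suffices h : x - transition I (U ∪ B) hU (transition I U hUB x) ∈
        arrowIdeal (canonicalIdeal I U) (restrictArrows (removeArrows U) B) by
      intro hx
      simpa [hx] using h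
    obtain ⟨z, rfl⟩ := Ideal.Quotient.mk_surjective x
    have key : ∀ p : QuiverPath (removeArrows U),
        ¬ p.PassesThrough (restrictArrows (removeArrows U) B) →
        transition I (U ∪ B) hU (transition I U hUB (Ideal.Quotient.mk _ (ofPath p))) =
          Ideal.Quotient.mk _ (ofPath p) := by
      intro p hp
      apply canonicalInclusion_injective I U
      rw [canonicalInclusion_transition_of_subset hU Set.subset_union_left,
        canonicalInclusion_transition, canonicalInclusion_mk, avoidingQuotientHom_mk,
        inclusion_ofPath, avoiding_ofPath_of_not_passesThrough]
      intro h
      rcases (pathPassesThrough_union U B _).1 h with h | h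
      · exact not_passesThrough_toAmbient U p h
      · exact hp ((passesThrough_toAmbient _ B p).1 h)
    induction z using induction_on with
    | path p =>
      by_cases hp : p.PassesThrough (restrictArrows (removeArrows U) B)
      · have h := ofPath_mem_arrowIdeal (I := canonicalIdeal I U) _ p hp
        exact TwoSidedIdeal.sub_mem _ h (transition_mem_arrowIdeal _ hU B _
          (transition_mem_arrowIdeal _ hUB B _ h))
      · rw [key p hp, sub_self]
        exact TwoSidedIdeal.zero_mem _
    | add x y hx hy =>
      have := TwoSidedIdeal.add_mem _ hx hy
      simp only [map_add]
      convert this using 1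
      abel
    | smul c x hx =>
      have h : ∀ x : PathAlgebra k (removeArrows U), c • x = (c • 1) * x := by simp
      have := TwoSidedIdeal.mul_mem_left _ (Ideal.Quotient.mk (canonicalIdeal I U) (c • 1)) _ hx
      have hc : transition I (U ∪ B) hU (transition I U hUB
          (Ideal.Quotient.mk (canonicalIdeal I U) (c • 1))) = Ideal.Quotient.mk _ (c • 1) := by
        rw [transition_mk_smul_one, transition_mk_smul_one]
      rw [h, map_mul, map_mul, map_mul, hc, ← mul_sub]
      exact this
    | zero =>
      simp only [map_zero, sub_self]
      exact TwoSidedIdeal.zero_mem _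

end Canonical

/-! ### Consequences of admissibility -/

section Admissible

open PathAlgebra

variable {k : Type u} {V : Type v} [Field k] [Quiver.{w} V] [Fintype V]
  {I : Ideal (PathAlgebra k V)} [I.IsTwoSided]

theorem ofPath_mem_of_le_length {N : ℕ}
    (hN : ∀ p : QuiverPath V, p.length = N → (ofPath p : PathAlgebra k V) ∈ I)
    (p : QuiverPath V) (hp : N ≤ p.length) : (ofPath p : PathAlgebra k V) ∈ I := by
  obtain ⟨a, b, p⟩ := p
  induction p with
  | nil => exact hN _ (le_antisymm (Nat.zero_le _) hp)
  | cons p e ih =>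
    rcases eq_or_lt_of_le hp with h | h
    · exact hN _ h.symm
    · rw [ofPath_cons]
      exact I.mul_mem_right _ (ih (Nat.lt_succ_iff.1 h))

variable (I) in
/-- The span in `kQ / I` of the paths of length at least `n`. -/
def pathFiltration (n : ℕ) : Submodule k (PathAlgebra k V ⧸ I) :=
  Submodule.span k {x | ∃ p : QuiverPath V, n ≤ p.length ∧ Ideal.Quotient.mk I (ofPath p) = x}

theorem mk_ofPath_mem_pathFiltration (n : ℕ) (p : QuiverPath V) (hp : n ≤ p.length) :
    Ideal.Quotient.mk I (ofPath p) ∈ pathFiltration I n :=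
  Submodule.subset_span ⟨p, hp, rfl⟩

theorem mul_mem_pathFiltration {m n : ℕ} {x y : PathAlgebra k V ⧸ I}
    (hx : x ∈ pathFiltration I m) (hy : y ∈ pathFiltration I n) :
    x * y ∈ pathFiltration I (m + n) := by
  induction hx using Submodule.span_induction with
  | mem x h =>
    obtain ⟨p, hp, rfl⟩ := h
    induction hy using Submodule.span_induction with
    | mem y h =>
      obtain ⟨q, hq, rfl⟩ := h
      rw [← map_mul, ofPath_mul_ofPath]
      obtain ⟨a, b, p⟩ := p
      obtain ⟨c, d, q⟩ := q
      by_cases h : b = c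
      · subst h
        rw [pathMul_of_eq]
        refine mk_ofPath_mem_pathFiltration _ _ ?_
        simp only [QuiverPath.length, Path.length_comp] at *
        omega
      · rw [pathMul_of_ne h, map_zero]
        exact Submodule.zero_mem _
    | zero => rw [mul_zero]; exact Submodule.zero_mem _
    | add y y' _ _ hy hy' => rw [mul_add]; exact Submodule.add_mem _ hy hy'
    | smul c y _ hy => rw [mul_smul_comm]; exact Submodule.smul_mem _ _ hy
  | zero => rw [zero_mul]; exact Submodule.zero_mem _
  | add x x' _ _ hx hx' => rw [add_mul]; exact Submodule.add_mem _ hx hx'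
  | smul c x _ hx => rw [smul_mul_assoc]; exact Submodule.smul_mem _ _ hx

theorem mem_pathFiltration_zero (x : PathAlgebra k V ⧸ I) : x ∈ pathFiltration I 0 := by
  obtain ⟨z, rfl⟩ := Ideal.Quotient.mk_surjective x
  induction z using induction_on with
  | path p => exact mk_ofPath_mem_pathFiltration 0 p (Nat.zero_le _)
  | add x y hx hy => rw [map_add]; exact Submodule.add_mem _ hx hy
  | smul c x hx => exact Submodule.smul_mem _ c hx
  | zero => rw [map_zero]; exact Submodule.zero_mem _

theorem sub_avoidingQuotientHom_mem {A : Set (Total V)} (hA : IsPreRemovable I A)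
    (x : PathAlgebra k V ⧸ I) : x - avoidingQuotientHom hA x ∈ pathFiltration I 1 := by
  obtain ⟨z, rfl⟩ := Ideal.Quotient.mk_surjective x
  rw [avoidingQuotientHom_mk, ← map_sub]
  induction z using induction_on with
  | path p =>
    by_cases hp : p.PassesThrough A
    · rw [avoiding_ofPath_of_passesThrough A p hp, sub_zero]
      exact mk_ofPath_mem_pathFiltration 1 p (length_pos_of_pathPassesThrough A p hp)
    · rw [avoiding_ofPath_of_not_passesThrough A p hp, sub_self, map_zero]
      exact Submodule.zero_mem _
  | add x y hx hy =>
    rw [avoiding_add, add_sub_add_comm, map_add]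
    exact Submodule.add_mem _ hx hy
  | smul c x hx =>
    rw [avoiding_smul, ← smul_sub]
    exact Submodule.smul_mem _ c hx
  | zero =>
    rw [avoiding_zero, sub_zero, map_zero]
    exact Submodule.zero_mem _

theorem exists_pathFiltration_eq_bot (hI : IsAdmissible I) : ∃ N, pathFiltration I N = ⊥ := by
  obtain ⟨N, -, hN⟩ := hI.exists_length
  refine ⟨N, ?_⟩
  rw [eq_bot_iff, pathFiltration, Submodule.span_le]
  rintro _ ⟨p, hp, rfl⟩
  exact Ideal.Quotient.eq_zero_iff_mem.2 (ofPath_mem_of_le_length hN p hp)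

/-- The kernel of the projection that removes arrows is nilpotent. -/
theorem exists_ker_transition_pow_eq_bot (hI : IsAdmissible I) (U : Set (Total V))
    {W : Set (Total V)} (hW : IsPreRemovable I W) :
    ∃ j, RingHom.ker (transition I U hW) ^ j = ⊥ := by
  obtain ⟨N, hN⟩ := exists_pathFiltration_eq_bot hI
  -- The kernel consists of combinations of paths of positive length, so its `n`-th power lies in
  -- the span of paths of length at least `n`. Measuring length in `kQ / I` means that only
  -- admissibility of `I` itself is needed.
  have key : ∀ n, ∀ x ∈ RingHom.ker (transition I U hW) ^ n,
      canonicalInclusion I U x ∈ pathFiltration I n := by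
    intro n
    induction n with
    | zero => exact fun x _ => mem_pathFiltration_zero _
    | succ n ih =>
      intro x hx
      rw [Submodule.pow_succ] at hx
      refine Submodule.smul_induction_on hx (fun r hr y hy => ?_) (fun x y hx hy => ?_)
      · rw [smul_eq_mul, map_mul]
        refine mul_mem_pathFiltration (ih r hr) ?_
        have h := sub_avoidingQuotientHom_mem hW (canonicalInclusion I U y)
        rwa [← canonicalInclusion_transition, RingHom.mem_ker.1 hy, map_zero, sub_zero] at h
      · rw [map_add]
        exact Submodule.add_mem _ hx hy
  refine ⟨N, ?_⟩
  rw [eq_bot_iff]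
  intro x hx
  have := key N x hx
  rw [hN, Submodule.mem_bot] at this
  exact canonicalInclusion_injective I U (by rw [this, map_zero])

variable (I) in
/-- The span in `kQ / I` of the products of a trivial path and `n` arrows. -/
def pathLayer : ℕ → Submodule k (PathAlgebra k V ⧸ I)
  | 0 => Submodule.span k
      (Set.range fun a : V => Ideal.Quotient.mk I (ofPath (QuiverPath.trivial a)))
  | n + 1 => pathLayer n * Submodule.span k
      (Set.range fun α : Total V => Ideal.Quotient.mk I (PathAlgebra.ofArrow α))

theorem mk_ofPath_mem_pathLayer (p : QuiverPath V) :
    Ideal.Quotient.mk I (ofPath p) ∈ pathLayer I p.length := by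
  obtain ⟨a, b, p⟩ := p
  induction p with
  | nil => exact Submodule.subset_span ⟨a, rfl⟩
  | cons p e ih =>
    rw [ofPath_cons, map_mul]
    exact Submodule.mul_mem_mul ih (Submodule.subset_span ⟨_, rfl⟩)

variable [∀ a b : V, Finite (a ⟶ b)]

omit [Field k] in
theorem finite_total : Finite (Total V) := by
  let f : (Σ a : V, Σ b : V, (a ⟶ b)) → Total V := fun x => ⟨x.1, x.2.1, x.2.2⟩
  exact Finite.of_surjective f fun α => ⟨⟨α.left, α.right, α.hom⟩, rfl⟩

theorem pathLayer_fg (n : ℕ) : (pathLayer I n).FG := by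
  have := finite_total (V := V)
  induction n with
  | zero => exact Submodule.fg_span (Set.finite_range _)
  | succ n ih => exact ih.mul (Submodule.fg_span (Set.finite_range _))

theorem finite_quotient (hI : IsAdmissible I) : Module.Finite k (PathAlgebra k V ⧸ I) := by
  obtain ⟨N, -, hN⟩ := hI.exists_length
  refine ⟨?_⟩
  -- Paths of length at least `N` vanish, so finitely many layers suffice, and each is finitely
  -- generated as a product of spans of finite sets.
  have h : (⊤ : Submodule k (PathAlgebra k V ⧸ I)) = ⨆ n : Fin N, pathLayer I n := by
    refine (eq_top_iff.2 ?_).symm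
    rintro x -
    obtain ⟨z, rfl⟩ := Ideal.Quotient.mk_surjective x
    induction z using induction_on with
    | path p =>
      by_cases hp : N ≤ p.length
      · rw [Ideal.Quotient.eq_zero_iff_mem.2 (ofPath_mem_of_le_length hN p hp)]
        exact Submodule.zero_mem _
      · exact le_iSup (fun n : Fin N => pathLayer I n) ⟨p.length, not_le.1 hp⟩
          (mk_ofPath_mem_pathLayer p)
    | add x y hx hy => rw [map_add]; exact Submodule.add_mem _ hx hy
    | smul c x hx => exact Submodule.smul_mem _ c hx
    | zero => rw [map_zero]; exact Submodule.zero_mem _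
  rw [h]
  exact Submodule.fg_iSup _ fun n => pathLayer_fg _

theorem isNoetherianRing_quotient (hI : IsAdmissible I) :
    IsNoetherianRing (PathAlgebra k V ⧸ I) := by
  have := finite_quotient hI
  exact isNoetherian_of_tower k inferInstance

theorem isNoetherianRing_canonicalRepresentation (hI : IsAdmissible I) (U : Set (Total V)) :
    IsNoetherianRing (CanonicalRepresentation I U) := by
  have := finite_quotient hI
  let f : CanonicalRepresentation I U →ₗ[k] PathAlgebra k V ⧸ I :=
    { toFun := canonicalInclusion I U
      map_add' := map_add _
      map_smul' := fun c x => by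
        obtain ⟨z, rfl⟩ := Ideal.Quotient.mk_surjective x
        exact congrArg (Ideal.Quotient.mk I) (map_smul (inclusion k (removeArrows U)) c z) }
  have : Module.Finite k (CanonicalRepresentation I U) :=
    Module.Finite.of_injective f (canonicalInclusion_injective I U)
  exact isNoetherian_of_tower k inferInstance

end Admissible

/-! ### Removable and eventually removable sets of arrows -/

section Removable

open PathAlgebra MulOpposite

variable {k : Type u} {V : Type v} [Field k] [Quiver.{w} V] [Fintype V]
  {I : Ideal (PathAlgebra k V)} [I.IsTwoSided]

/-- The negative clause in `IsOnlyLeftRemovable` only makes the two cases exclusive. It disappears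
in their disjunction. -/
theorem isRemovable_iff (A : Set (Total V)) :
    IsRemovable I A ↔
      IsPreRemovable I A ∧ HasFiniteRightPD I A ∧ (HasFiniteLeftPD I A ∨ IsNonRepetitive I A) := by
  unfold IsRemovable IsTwoSidedRemovable IsOnlyLeftRemovable
  tauto

theorem IsRemovableAfter.isPreRemovable {U B : Set (Total V)} (hU : IsPreRemovable I U)
    (h : IsRemovableAfter I U B) : IsPreRemovable I (U ∪ B) :=
  (isPreRemovable_canonicalIdeal_iff hU).1 ((isRemovable_iff _).1 h).1

theorem IsRemovableAfter.hasFinitisticBound_iff [∀ a b : V, Finite (a ⟶ b)] (hI : IsAdmissible I)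
    {U B : Set (Total V)} (hU : IsPreRemovable I U) (h : IsRemovableAfter I U B) (p : Prop) :
    HasFinitisticBound p (CanonicalRepresentation I U) ↔
      HasFinitisticBound p (CanonicalRepresentation I (U ∪ B)) := by
  have hUB := h.isPreRemovable hU
  obtain ⟨-, hr, hl⟩ := (isRemovable_iff _).1 h
  exact _root_.hasFinitisticBound_iff (transition I U hUB) (transition I (U ∪ B) hU)
    (transition_transition_of_subset hU hUB Set.subset_union_left) _ (mem_arrowIdeal_iff hU hUB) p
    (fun _ => isNoetherianRing_canonicalRepresentation hI _)
    (fun _ => isNoetherianRing_canonicalRepresentation hI _)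
    (exists_ker_transition_pow_eq_bot hI U hUB) hr hl

theorem IsRemovableAfter.hasGlobalBound_iff (hI : IsAdmissible I)
    {U B : Set (Total V)} (hU : IsPreRemovable I U) (h : IsRemovableAfter I U B) :
    HasGlobalBound (CanonicalRepresentation I U) ↔
      HasGlobalBound (CanonicalRepresentation I (U ∪ B)) := by
  have hUB := h.isPreRemovable hU
  obtain ⟨-, hr, -⟩ := (isRemovable_iff _).1 h
  exact _root_.hasGlobalBound_iff (transition I U hUB) (transition I (U ∪ B) hU)
    (transition_transition_of_subset hU hUB Set.subset_union_left) _ (mem_arrowIdeal_iff hU hUB)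
    (exists_ker_transition_pow_eq_bot hI U hUB) hr

/-- The projection and its section both respect the ideals generated by `B`, so the ideal at stage
`W` is a semilinear retract of the one at stage `U`. -/
theorem HasFiniteLeftPD.mono {U W B : Set (Total V)} (hU : IsPreRemovable I U)
    (hW : IsPreRemovable I W) (hUW : U ⊆ W)
    (h : HasFiniteLeftPD (canonicalIdeal I U) (restrictArrows (removeArrows U) B)) :
    HasFiniteLeftPD (canonicalIdeal I W) (restrictArrows (removeArrows W) B) := by
  obtain ⟨n, hn⟩ := (projectiveDimension_lt_top_iff _).1 h
  refine (projectiveDimension_lt_top_iff _).2 ⟨n, ?_⟩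
  let a : arrowIdeal (canonicalIdeal I U) (restrictArrows (removeArrows U) B)
      →ₛₗ[transition I U hW] arrowIdeal (canonicalIdeal I W) (restrictArrows (removeArrows W) B) :=
    { toFun := fun x => ⟨transition I U hW x, transition_mem_arrowIdeal U hW B x x.2⟩
      map_add' := fun x y => Subtype.ext (map_add (transition I U hW) x.1 y.1)
      map_smul' := fun r x => Subtype.ext (map_mul (transition I U hW) r x.1) }
  let b : arrowIdeal (canonicalIdeal I W) (restrictArrows (removeArrows W) B)
      →ₛₗ[transition I W hU] arrowIdeal (canonicalIdeal I U) (restrictArrows (removeArrows U) B) :=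
    { toFun := fun x => ⟨transition I W hU x, transition_mem_arrowIdeal W hU B x x.2⟩
      map_add' := fun x y => Subtype.ext (map_add (transition I W hU) x.1 y.1)
      map_smul' := fun r x => Subtype.ext (map_mul (transition I W hU) r x.1) }
  have hπν := transition_transition_of_subset hU hW hUW
  exact hasProjectiveDimensionLT_of_semilinear_retract _ _ hπν n a b
    (fun x => Subtype.ext (hπν x)) hn

theorem HasFiniteRightPD.mono {U W B : Set (Total V)} (hU : IsPreRemovable I U)
    (hW : IsPreRemovable I W) (hUW : U ⊆ W)
    (h : HasFiniteRightPD (canonicalIdeal I U) (restrictArrows (removeArrows U) B)) :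
    HasFiniteRightPD (canonicalIdeal I W) (restrictArrows (removeArrows W) B) := by
  obtain ⟨n, hn⟩ := (projectiveDimension_lt_top_iff _).1 h
  refine (projectiveDimension_lt_top_iff _).2 ⟨n, ?_⟩
  let a : arrowIdeal (canonicalIdeal I U) (restrictArrows (removeArrows U) B)
      →ₛₗ[(transition I U hW).op]
        arrowIdeal (canonicalIdeal I W) (restrictArrows (removeArrows W) B) :=
    { toFun := fun x => ⟨transition I U hW x, transition_mem_arrowIdeal U hW B x x.2⟩
      map_add' := fun x y => Subtype.ext (map_add (transition I U hW) x.1 y.1)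
      map_smul' := fun r x => Subtype.ext (map_mul (transition I U hW) x.1 r.unop) }
  let b : arrowIdeal (canonicalIdeal I W) (restrictArrows (removeArrows W) B)
      →ₛₗ[(transition I W hU).op]
        arrowIdeal (canonicalIdeal I U) (restrictArrows (removeArrows U) B) :=
    { toFun := fun x => ⟨transition I W hU x, transition_mem_arrowIdeal W hU B x x.2⟩
      map_add' := fun x y => Subtype.ext (map_add (transition I W hU) x.1 y.1)
      map_smul' := fun r x => Subtype.ext (map_mul (transition I W hU) x.1 r.unop) }
  have hπν := transition_transition_of_subset hU hW hUW
  exact hasProjectiveDimensionLT_of_semilinear_retract (transition I U hW).op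
    (transition I W hU).op (fun s => unop_injective (hπν s.unop)) n a b (fun x => Subtype.ext (hπν x)) hn

theorem IsNonRepetitive.mono {U W B : Set (Total V)} (hU : IsPreRemovable I U)
    (hW : IsPreRemovable I W) (hUW : U ⊆ W)
    (h : IsNonRepetitive (canonicalIdeal I U) (restrictArrows (removeArrows U) B)) :
    IsNonRepetitive (canonicalIdeal I W) (restrictArrows (removeArrows W) B) := by
  intro x hx y hy
  rw [← transition_transition_of_subset hU hW hUW x, ← transition_transition_of_subset hU hW hUW y,
    ← map_mul, h _ (transition_mem_arrowIdeal W hU B x hx) _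
      (transition_mem_arrowIdeal W hU B y hy), map_zero]

/-- Removability persists when a larger pre-removable set is removed beforehand. -/
theorem IsRemovableAfter.mono {U W B : Set (Total V)} (hU : IsPreRemovable I U)
    (hW : IsPreRemovable I W) (hUW : U ⊆ W) (h : IsRemovableAfter I U B) :
    IsRemovableAfter I W B := by
  have hUB := h.isPreRemovable hU
  obtain ⟨-, hr, hl⟩ := (isRemovable_iff _).1 h
  refine (isRemovable_iff _).2 ⟨(isPreRemovable_canonicalIdeal_iff hW).2 ?_, hr.mono hU hW hUW,
    hl.imp (fun h => h.mono hU hW hUW) (fun h => h.mono hU hW hUW)⟩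
  -- `B` alone need not be pre-removable in `kQ / I`, but `U ∪ B` is, and pre-removable sets are
  -- closed under unions.
  have : W ∪ B = W ∪ (U ∪ B) := by
    rw [← Set.union_assoc, Set.union_eq_self_of_subset_right hUW]
  rw [this]
  exact hW.union hUB

/-- The arrows in `U` are already absent at this stage. Hence the parts of a successive removal may
be taken disjoint. -/
theorem isRemovableAfter_diff {U B : Set (Total V)} :
    IsRemovableAfter I U (B \ U) ↔ IsRemovableAfter I U B := by
  have : restrictArrows (removeArrows U) (B \ U) = restrictArrows (removeArrows U) B := by
    ext α
    exact ⟨fun h => h.1, fun h => ⟨h, α.hom.2⟩⟩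
  unfold IsRemovableAfter
  rw [this]

variable (I) in
/-- The sets of arrows that can be removed by finitely many removals of removable sets. -/
inductive IsSuccessivelyRemovable : Set (Total V) → Prop
  | empty : IsSuccessivelyRemovable ∅
  | union {U B : Set (Total V)} : IsSuccessivelyRemovable U → IsRemovableAfter I U B →
      IsSuccessivelyRemovable (U ∪ B)

theorem IsSuccessivelyRemovable.isPreRemovable {A : Set (Total V)}
    (h : IsSuccessivelyRemovable I A) : IsPreRemovable I A := by
  induction h with
  | empty => exact isPreRemovable_empty I
  | union _ hB ih => exact hB.isPreRemovable ih

/-- Remove `A`, then repeat the removals leading to `B`. Each remains legitimate after the larger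
prior removal by `IsRemovableAfter.mono`. -/
theorem IsSuccessivelyRemovable.sup {A B : Set (Total V)} (hA : IsSuccessivelyRemovable I A)
    (hB : IsSuccessivelyRemovable I B) : IsSuccessivelyRemovable I (A ∪ B) := by
  induction hB with
  | empty => rwa [Set.union_empty]
  | union hU hC ih =>
    rw [← Set.union_assoc]
    exact ih.union (hC.mono hU.isPreRemovable ih.isPreRemovable Set.subset_union_right)

theorem IsEventuallyRemovable.isSuccessivelyRemovable {A : Set (Total V)}
    (h : IsEventuallyRemovable I A) : IsSuccessivelyRemovable I A := by
  obtain ⟨m, P, -, rfl, hP⟩ := h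
  have key : ∀ j ≤ m, IsSuccessivelyRemovable I (⋃ (i : Fin m) (_ : i.1 < j), P i) := by
    intro j
    induction j with
    | zero =>
      intro _
      simpa using IsSuccessivelyRemovable.empty (I := I)
    | succ j ih =>
      intro hj
      have h := (ih (by omega)).union (hP ⟨j, hj⟩)
      convert h using 1
      ext α
      simp only [Set.mem_iUnion, Set.mem_union, exists_prop]
      constructor
      · rintro ⟨i, hi, h⟩
        rcases Nat.lt_succ_iff_lt_or_eq.1 hi with hi | hi
        · exact Or.inl ⟨i, hi, h⟩
        · right
          rwa [show (⟨j, hj⟩ : Fin m) = i from Fin.ext hi.symm]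
      · rintro (⟨i, hi, h⟩ | h)
        · exact ⟨i, by omega, h⟩
        · exact ⟨⟨j, hj⟩, Nat.lt_succ_self j, h⟩
  simpa using key m le_rfl

theorem IsSuccessivelyRemovable.isEventuallyRemovable {A : Set (Total V)}
    (h : IsSuccessivelyRemovable I A) : IsEventuallyRemovable I A := by
  induction h with
  | empty => exact ⟨0, Fin.elim0, fun i => i.elim0, by simp, fun i => i.elim0⟩
  | @union U B _ hB ih =>
    obtain ⟨m, P, hd, hU, hP⟩ := ih
    refine ⟨m + 1, Fin.snoc P (B \ U), ?_, ?_, ?_⟩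
    · intro i j hij
      induction i using Fin.lastCases with
      | last =>
        induction j using Fin.lastCases with
        | last => exact absurd rfl hij
        | cast j =>
          rw [Fin.snoc_last, Fin.snoc_castSucc]
          refine Set.disjoint_sdiff_left.mono_right ?_
          rw [← hU]
          exact Set.subset_iUnion P j
      | cast i =>
        induction j using Fin.lastCases with
        | last =>
          rw [Fin.snoc_last, Fin.snoc_castSucc]
          refine Set.disjoint_sdiff_right.mono_left ?_
          rw [← hU]
          exact Set.subset_iUnion P i
        | cast j =>
          rw [Fin.snoc_castSucc, Fin.snoc_castSucc]
          exact hd fun h => hij (by rw [h])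
    · ext α
      simp only [Set.mem_iUnion, Fin.exists_fin_succ', Fin.snoc_castSucc, Fin.snoc_last]
      rw [← Set.mem_iUnion, hU, ← Set.mem_union, Set.union_sdiff_self]
    · intro j
      have hlast : ∀ j : Fin m, (⋃ (i : Fin (m + 1)) (_ : i < j.castSucc),
          (Fin.snoc P (B \ U) : Fin (m + 1) → Set (Total V)) i) = ⋃ (i : Fin m) (_ : i < j), P i := by
        intro j
        ext α
        simp only [Set.mem_iUnion, Fin.exists_fin_succ', Fin.snoc_castSucc, Fin.snoc_last,
          Fin.castSucc_lt_castSucc_iff, exists_prop, not_lt_of_ge (Fin.le_last j.castSucc),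
          false_and, or_false]
      induction j using Fin.lastCases with
      | last =>
        have : (⋃ (i : Fin (m + 1)) (_ : i < Fin.last m),
            (Fin.snoc P (B \ U) : Fin (m + 1) → Set (Total V)) i) = U := by
          rw [← hU]
          ext α
          simp only [Set.mem_iUnion, Fin.exists_fin_succ', Fin.snoc_castSucc, Fin.snoc_last,
            Fin.castSucc_lt_last, exists_prop, lt_irrefl, false_and, or_false, true_and]
        rw [this, Fin.snoc_last]
        exact isRemovableAfter_diff.2 hB
      | cast j =>
        rw [hlast, Fin.snoc_castSucc]
        exact hP j

variable (I) in
-- Existence holds because there are only finitely many sets of arrows. Two maximal sets both equal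
-- their union, which is again eventually removable.
theorem existsUnique_isMaximalEventuallyRemovable [∀ a b : V, Finite (a ⟶ b)] :
    ∃! A : Set (Total V), IsMaximalEventuallyRemovable I A := by
  have := finite_total (V := V)
  obtain ⟨A, -, hA⟩ := Finite.exists_le_maximal (p := IsEventuallyRemovable I)
    IsSuccessivelyRemovable.empty.isEventuallyRemovable
  refine ⟨A, hA, fun B hB => ?_⟩
  have h : IsEventuallyRemovable I (A ∪ B) :=
    (hA.1.isSuccessivelyRemovable.sup hB.1.isSuccessivelyRemovable).isEventuallyRemovable
  exact Set.Subset.antisymm (Set.subset_union_right.trans (hA.2 h Set.subset_union_left))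
    (Set.subset_union_left.trans (hB.2 h Set.subset_union_right))

end Removable

/-! ### Global dimension and semisimplicity -/

section GlobalDimension

open PathAlgebra MulOpposite

theorem exists_ker_op_pow_eq_bot {R S : Type u} [Ring R] [Ring S] (f : R →+* S)
    (h : ∃ j, RingHom.ker f ^ j = ⊥) : ∃ j, RingHom.ker f.op ^ j = ⊥ := by
  have key : ∀ n, ∀ x ∈ RingHom.ker f.op ^ n, unop x ∈ RingHom.ker f ^ n := by
    intro n
    induction n with
    | zero =>
      intro x _
      rw [Submodule.pow_zero, Ideal.one_eq_top]
      trivial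
    | succ n ih =>
      intro x hx
      rw [Submodule.pow_succ] at hx
      -- Taking opposites reverses products, so the additional factor has to be split off on the
      -- other side.
      rw [Ideal.IsTwoSided.pow_succ]
      refine Submodule.smul_induction_on hx (fun r hr y hy => ?_) (fun x y hx hy => ?_)
      · exact Submodule.smul_mem_smul (op_injective hy : f y.unop = 0) (ih r hr)
      · exact Submodule.add_mem _ hx hy
  obtain ⟨j, hj⟩ := h
  refine ⟨j, eq_bot_iff.2 fun x hx => ?_⟩
  have := key j x hx
  rw [hj, Submodule.mem_bot] at this
  exact unop_injective this

theorem HasGlobalBound.of_isSemisimpleRing (R : Type u) [Ring R] [IsSemisimpleRing R] :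
    HasGlobalBound R :=
  ⟨0, fun M => by
    have : Module.Projective R M := Module.projective_of_isSemisimpleRing R M
    exact projective_iff_hasProjectiveDimensionLT_one.1
      (ModuleCat.projective_of_categoryTheory_projective M)⟩

/-- If the kernel of a split surjection onto a semisimple ring is nilpotent and of finite projective
dimension as a left module, then every right module has finite projective dimension. -/
theorem HasGlobalBound.op_of_left_pd {R S : Type u} [Ring R] [Ring S] [IsSemisimpleRing S]
    (π : R →+* S) (ν : S →+* R) (hπν : ∀ s, π (ν s) = s) (K : TwoSidedIdeal R)
    (hK : ∀ x, x ∈ K ↔ π x = 0) (hnil : ∃ j, RingHom.ker π ^ j = ⊥)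
    (h : projectiveDimension (ModuleCat.of R K) < ⊤) : HasGlobalBound Rᵐᵒᵖ := by
  have hK' : ∀ x, x ∈ TwoSidedIdeal.ker π.op ↔ π.op x = 0 := fun x => TwoSidedIdeal.mem_ker _
  refine HasGlobalBound.of_quotient π.op ν.op (fun s => unop_injective (hπν s.unop))
    (TwoSidedIdeal.ker π.op) hK' (exists_ker_op_pow_eq_bot π hnil) ?_
    (HasGlobalBound.of_isSemisimpleRing Sᵐᵒᵖ)
  obtain ⟨n, hn⟩ := (projectiveDimension_lt_top_iff _).1 h
  refine (projectiveDimension_lt_top_iff _).2 ⟨n, ?_⟩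
  -- A right module over `Rᵐᵒᵖ` is a left `R`-module up to this double opposite. Hence the
  -- hypothesis on right projective dimension over `Rᵐᵒᵖ` is the given one on the left module `K`.
  let e : R ≃+* Rᵐᵒᵖᵐᵒᵖ := RingEquiv.opOp R
  let a : K →ₛₗ[(e : R →+* Rᵐᵒᵖᵐᵒᵖ)] TwoSidedIdeal.ker π.op :=
    { toFun := fun x => ⟨op x.1, (hK' _).2 (unop_injective ((hK _).1 x.2))⟩
      map_add' := fun x y => rfl
      map_smul' := fun r x => rfl }
  let b : TwoSidedIdeal.ker π.op →ₛₗ[(e.symm : Rᵐᵒᵖᵐᵒᵖ →+* R)] K :=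
    { toFun := fun x => ⟨unop x.1, (hK _).2 (op_injective ((hK' _).1 x.2))⟩
      map_add' := fun x y => rfl
      map_smul' := fun r x => rfl }
  exact hasProjectiveDimensionLT_of_semilinear_retract (e : R →+* Rᵐᵒᵖᵐᵒᵖ)
    (e.symm : Rᵐᵒᵖᵐᵒᵖ →+* R) (fun s => rfl) n a b (fun x => rfl) hn

variable {k : Type u} {V : Type v} [Field k] [Quiver.{w} V] [Fintype V]

/-- Paths occurring in `I` have length at least two, so elements of `I` have no component avoiding
all arrows. -/
theorem isPreRemovable_univ {I : Ideal (PathAlgebra k V)} (hI : IsAdmissible I) :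
    IsPreRemovable I Set.univ := by
  rw [isPreRemovable_iff]
  intro z hz
  have : avoiding Set.univ z = 0 := by
    rw [avoiding, ofCoeff, LinearEquiv.map_eq_zero_iff, Finsupp.filter_eq_zero_iff]
    intro p hp
    by_contra h
    have := hI.two_le_length z hz p (Finsupp.mem_support_iff.2 h)
    exact hp (passesThrough_univ_of_length_pos p (by omega))
  rw [this]
  exact I.zero_mem

/-- The linear combinations of trivial paths, as a ring homomorphism. -/
def trivialPathsHom (k : Type u) (V : Type v) [Field k] [Quiver.{w} V] [Fintype V] :
    (V → k) →+* PathAlgebra k V where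
  toFun g := ∑ a, g a • ofPath (QuiverPath.trivial a)
  map_one' := by simp [one_def]
  map_zero' := by simp
  map_add' g h := by simp [add_smul, Finset.sum_add_distrib]
  map_mul' g h := by
    rw [Finset.sum_mul_sum]
    refine Finset.sum_congr rfl fun a _ => ?_
    rw [Finset.sum_eq_single a]
    · rw [smul_mul_smul_comm, ofPath_mul_ofPath]
      exact congrArg _ (pathMul_of_eq (Path.nil : Path a a) Path.nil).symm
    · intro b _ hb
      rw [smul_mul_smul_comm, ofPath_mul_ofPath, pathMul_of_ne, smul_zero]
      exact fun h => hb h.symm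
    · simp

theorem trivialPathsHom_surjective [∀ a b : V, IsEmpty (a ⟶ b)] :
    Function.Surjective (trivialPathsHom k V) := by
  classical
  intro z
  induction z using induction_on with
  | path p =>
    obtain ⟨a, b, p⟩ := p
    cases p with
    | nil =>
      refine ⟨Pi.single a 1, ?_⟩
      show ∑ b, (Pi.single a 1 : V → k) b • (ofPath (QuiverPath.trivial b) : PathAlgebra k V) = _
      rw [Finset.sum_eq_single a]
      · rw [Pi.single_eq_same, one_smul]
        rfl
      · intro b _ hb
        rw [Pi.single_eq_of_ne hb, zero_smul]
      · simp
    | cons p e => exact isEmptyElim e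
  | add x y hx hy =>
    obtain ⟨x, rfl⟩ := hx
    obtain ⟨y, rfl⟩ := hy
    exact ⟨x + y, map_add _ _ _⟩
  | smul c x hx =>
    obtain ⟨x, rfl⟩ := hx
    refine ⟨c • x, ?_⟩
    show ∑ a, (c • x) a • (ofPath (QuiverPath.trivial a) : PathAlgebra k V) =
      c • ∑ a, x a • ofPath (QuiverPath.trivial a)
    simp [Finset.smul_sum, mul_smul]
  | zero => exact ⟨0, map_zero _⟩

variable {I : Ideal (PathAlgebra k V)} [I.IsTwoSided]

variable (I) in
-- Without arrows only trivial paths remain, so the algebra is a quotient of the semisimple ring `V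
-- → k`.
theorem isSemisimpleRing_canonicalRepresentation_univ :
    IsSemisimpleRing (CanonicalRepresentation I Set.univ) := by
  have (a b : removeArrows (Set.univ : Set (Total V))) : IsEmpty (a ⟶ b) := ⟨fun e => e.2 trivial⟩
  have : Finite (removeArrows (Set.univ : Set (Total V)) : Type v) := inferInstanceAs (Finite V)
  exact RingHom.isSemisimpleRing_of_surjective
    ((Ideal.Quotient.mk (canonicalIdeal I Set.univ)).comp (trivialPathsHom k _))
    (Ideal.Quotient.mk_surjective.comp trivialPathsHom_surjective)

theorem canonicalProjection_empty_eq_zero_iff (x : PathAlgebra k V ⧸ I) :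
    x ∈ (⊥ : TwoSidedIdeal (PathAlgebra k V ⧸ I)) ↔
      canonicalProjection (isPreRemovable_empty I) x = 0 := by
  rw [TwoSidedIdeal.mem_bot]
  refine ⟨fun h => by rw [h, map_zero], fun h => ?_⟩
  have h' := canonicalInclusion_canonicalProjection (isPreRemovable_empty I) x
  obtain ⟨z, rfl⟩ := Ideal.Quotient.mk_surjective x
  rw [h, map_zero, avoidingQuotientHom_mk, avoiding_empty] at h'
  exact h'.symm

theorem ker_canonicalProjection_empty :
    ∃ j, RingHom.ker (canonicalProjection (isPreRemovable_empty I)) ^ j = ⊥ := by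
  refine ⟨1, ?_⟩
  rw [Submodule.pow_one, eq_bot_iff]
  intro x hx
  have := (canonicalProjection_empty_eq_zero_iff x).2 hx
  rwa [TwoSidedIdeal.mem_bot] at this

theorem projectiveDimension_lt_top_of_subsingleton {R : Type u} [Ring R] (M : Type u)
    [AddCommGroup M] [Module R M] [Subsingleton M] :
    projectiveDimension (ModuleCat.of R M) < ⊤ := by
  rw [(projectiveDimension_eq_bot_iff _).2 (ModuleCat.isZero_of_subsingleton _)]
  exact bot_lt_top

variable (I) in
theorem subsingleton_bot : Subsingleton (⊥ : TwoSidedIdeal (PathAlgebra k V ⧸ I)) :=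
  ⟨fun x y => Subtype.ext <| by
    rw [(TwoSidedIdeal.mem_bot _).1 x.2, (TwoSidedIdeal.mem_bot _).1 y.2]⟩

/-- Removing no arrows gives an isomorphic ring over a different quiver type. The comparison is the
general one for split surjections with zero kernel. -/
theorem hasGlobalBound_canonicalRepresentation_empty_iff :
    HasGlobalBound (PathAlgebra k V ⧸ I) ↔ HasGlobalBound (CanonicalRepresentation I ∅) := by
  have := subsingleton_bot I
  exact hasGlobalBound_iff (canonicalProjection (isPreRemovable_empty I)) (canonicalInclusion I ∅)
    (canonicalProjection_canonicalInclusion _) ⊥ canonicalProjection_empty_eq_zero_iff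
    ker_canonicalProjection_empty (projectiveDimension_lt_top_of_subsingleton _)

theorem hasFinitisticBound_canonicalRepresentation_empty_iff [∀ a b : V, Finite (a ⟶ b)]
    (hI : IsAdmissible I) (p : Prop) :
    HasFinitisticBound p (PathAlgebra k V ⧸ I) ↔
      HasFinitisticBound p (CanonicalRepresentation I ∅) := by
  have := subsingleton_bot I
  exact hasFinitisticBound_iff (canonicalProjection (isPreRemovable_empty I))
    (canonicalInclusion I ∅) (canonicalProjection_canonicalInclusion _) ⊥
    canonicalProjection_empty_eq_zero_iff p (fun _ => isNoetherianRing_quotient hI)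
    (fun _ => isNoetherianRing_canonicalRepresentation hI _)
    ker_canonicalProjection_empty (projectiveDimension_lt_top_of_subsingleton _)
    (Or.inl (projectiveDimension_lt_top_of_subsingleton _))

theorem IsSuccessivelyRemovable.hasFinitisticBound_iff [∀ a b : V, Finite (a ⟶ b)]
    (hI : IsAdmissible I) {A : Set (Total V)} (hA : IsSuccessivelyRemovable I A) (p : Prop) :
    HasFinitisticBound p (PathAlgebra k V ⧸ I) ↔
      HasFinitisticBound p (CanonicalRepresentation I A) := by
  induction hA with
  | empty => exact hasFinitisticBound_canonicalRepresentation_empty_iff hI p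
  | union hU hB ih => exact ih.trans (hB.hasFinitisticBound_iff hI hU.isPreRemovable p)

theorem IsSuccessivelyRemovable.hasGlobalBound_iff
    (hI : IsAdmissible I) {A : Set (Total V)} (hA : IsSuccessivelyRemovable I A) :
    HasGlobalBound (PathAlgebra k V ⧸ I) ↔ HasGlobalBound (CanonicalRepresentation I A) := by
  induction hA with
  | empty => exact hasGlobalBound_canonicalRepresentation_empty_iff
  | union hU hB ih => exact ih.trans (hB.hasGlobalBound_iff hI hU.isPreRemovable)

/-- If the global dimension is finite, then the set of all arrows is removable. -/
theorem isRemovableAfter_empty_univ (hI : IsAdmissible I)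
    (h : HasGlobalBound (PathAlgebra k V ⧸ I)) : IsRemovableAfter I ∅ Set.univ := by
  have h₀ := isPreRemovable_empty I
  have h₁ : IsPreRemovable I (∅ ∪ Set.univ) := h₀.union (isPreRemovable_univ hI)
  obtain ⟨n, hn⟩ := hasGlobalBound_canonicalRepresentation_empty_iff.1 h
  have hl : HasFiniteLeftPD (canonicalIdeal I ∅) (restrictArrows (removeArrows ∅) Set.univ) :=
    (projectiveDimension_lt_top_iff _).2 ⟨n, hn _⟩
  have : IsSemisimpleRing (CanonicalRepresentation I (∅ ∪ Set.univ)) := by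
    rw [Set.empty_union]
    exact isSemisimpleRing_canonicalRepresentation_univ I
  -- Finite left global dimension gives only the left projective dimension of the ideal of all
  -- arrows. The right one follows because the quotient by this ideal is semisimple.
  obtain ⟨n', hn'⟩ := HasGlobalBound.op_of_left_pd (transition I ∅ h₁)
    (transition I (∅ ∪ Set.univ) h₀)
    (transition_transition_of_subset h₀ h₁ Set.subset_union_left) _ (mem_arrowIdeal_iff h₀ h₁)
    (exists_ker_transition_pow_eq_bot hI ∅ h₁) hl
  exact (isRemovable_iff _).2 ⟨(isPreRemovable_canonicalIdeal_iff h₀).2 h₁,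
    (projectiveDimension_lt_top_iff _).2 ⟨n', hn' _⟩, Or.inl hl⟩

theorem isSemisimpleRing_of_hasGlobalBound (hI : IsAdmissible I) {A : Set (Total V)}
    (hA : IsMaximalEventuallyRemovable I A) (h : HasGlobalBound (PathAlgebra k V ⧸ I)) :
    IsSemisimpleRing (CanonicalRepresentation I A) := by
  have hu : IsEventuallyRemovable I (∅ ∪ Set.univ) :=
    (IsSuccessivelyRemovable.empty.union (isRemovableAfter_empty_univ hI h)).isEventuallyRemovable
  rw [Set.empty_union] at hu
  -- All arrows can be removed, so the maximal set contains every arrow.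
  have hA' : A = Set.univ := Set.univ_subset_iff.1 (hA.2 hu (Set.subset_univ A))
  rw [hA']
  exact isSemisimpleRing_canonicalRepresentation_univ I

end GlobalDimension

theorem mainTheorem4 {k : Type u} {V : Type v} [Field k] [Quiver.{w} V] [Fintype V]
    [∀ a b : V, Finite (a ⟶ b)] (I : Ideal (PathAlgebra k V)) [I.IsTwoSided]
    (hI : IsAdmissible I) :
    (∃! A : Set (Total V), IsMaximalEventuallyRemovable I A) ∧
    ∀ A : Set (Total V), IsMaximalEventuallyRemovable I A →
      (littleFinitisticDimension (PathAlgebra k V ⧸ I) < ⊤ ↔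
        littleFinitisticDimension (CanonicalRepresentation I A) < ⊤) ∧
      (bigFinitisticDimension (PathAlgebra k V ⧸ I) < ⊤ ↔
        bigFinitisticDimension (CanonicalRepresentation I A) < ⊤) ∧
      (globalDimension (PathAlgebra k V ⧸ I) < ⊤ ↔
        globalDimension (CanonicalRepresentation I A) < ⊤) ∧
      (globalDimension (PathAlgebra k V ⧸ I) < ⊤ ↔
        IsSemisimpleRing (CanonicalRepresentation I A)) := by
  refine ⟨existsUnique_isMaximalEventuallyRemovable I, fun A hA => ?_⟩
  have hA' := hA.1.isSuccessivelyRemovable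
  simp only [littleFinitisticDimension_lt_top_iff, bigFinitisticDimension_lt_top_iff,
    globalDimension_lt_top_iff]
  refine ⟨hA'.hasFinitisticBound_iff hI True, hA'.hasFinitisticBound_iff hI False,
    hA'.hasGlobalBound_iff hI, isSemisimpleRing_of_hasGlobalBound hI hA, fun h => ?_⟩
  exact (hA'.hasGlobalBound_iff hI).2 (HasGlobalBound.of_isSemisimpleRing _)

end
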